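/- Let $\mathsf A$ be an abelian category and let $\mathsf U$ be a full subcategory of $\mathsf A$, closed under isomorphisms, which is additively closed, i.e. closed under finite direct sums (including the zero object) and direct summands. Let $\mathsf U^\perp$ be the full subcategory of objects $N$ with $\operatorname{Ext}^1_{\mathsf A}(U,N)=0$ for all $U\in\mathsf U$. A complex $T$ in $\mathsf A$ is *right $\mathsf U$-totally acyclic* if it is acyclic, every $T_i$ belongs to $\mathsf U$, every cycle object $\mathrm Z_i(T)$ belongs to $\mathsf U^\perp$, and the complex $\operatorname{hom}_{\mathsf A}(T,W)$ is acyclic for every $W\in\mathsf U\cap\mathsf U^\perp$. An object is *right $\mathsf U$-Gorenstein* if it is isomorphic to $\mathrm Z_0(T)$ for some right $\mathsf U$-totally acyclic complex $T$. Let $\mathsf G$ be the full subcategory of right $\mathsf U$-Gorenstein objects, with the short exact sequences of $\mathsf A$ whose terms lie in $\mathsf G$ as conflations. Let $\underline{\mathsf G}$ be its stable category, i.e. the quotient of $\mathsf G$ by the morphisms that factor through a projective-injective object of $\mathsf G$. Let $\mathsf K$ be the homotopy category of right $\mathsf U$-totally acyclic complexes, a triangulated subcategory of the homotopy category of $\mathsf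 A$. Write $\mathrm Z_0\colon\mathsf K\to\underline{\mathsf G}$ for the functor that sends $T$ to $\mathrm Z_0(T)$ and the homotopy class of $\phi$ to the stable class of $\mathrm Z_0(\phi)$. Then $\mathsf G$ is a Frobenius category, and $\underline{\mathsf G}$ is a triangulated category with its standard structure: there are morphisms $\delta\colon X_3\to\Sigma X_1$ in $\underline{\mathsf G}$, natural in the conflation $0\to X_1\to X_2\to X_3\to 0$ and invertible when $X_2$ is injective in $\mathsf G$, such that the distinguished triangles are, up to isomorphism, the triangles $X_1\to X_2\to X_3\xrightarrow{\delta}\Sigma X_1$ given by conflations. Moreover, choose for every right $\mathsf U$-Gorenstein object $M$ a right $\mathsf U$-totally acyclic complex $\mathrm T(M)$ with an isomorphism $\mathrm Z_0(\mathrm T(M))\cong M$. Then every morphism $f\colon M\to M'$ in $\mathsf G$ is induced on $\mathrm Z_0$, via these isomorphisms, by some chain map $\phi\colon\mathrm T(M)\to\mathrm T(M')$, and $M\mapsto\mathrm T(M)$, $[f]\mapsto[\phi]$ (for any such $\phi$) is a well-defined functor $\mathrm T\colon\underline{\mathsf G}\to\mathsf K$. The functors $$\mathrm T\colon\underline{\mathsf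 G}\longrightarrow\mathsf K\qquad\text{and}\qquad \mathrm Z_0\colon\mathsf K\longrightarrow\underline{\mathsf G}$$ are triangulated functors and equivalences of categories, $\mathrm T$ is both left adjoint and right adjoint to $\mathrm Z_0$, and both adjunctions can be chosen compatible with the shifts. -/

import Mathlib

open CategoryTheory Limits ZeroObject

universe v u

namespace RightGorenstein

variable {A : Type u} [Category.{v} A] [Abelian A]

/-- The right orthogonal of a subcategory `U`: the objects `N` such that `Ext¹(X, N) = 0` for every
`X` in `U`. -/
def rightOrthogonal (U : ObjectProperty A) : ObjectProperty A := fun N =>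
  haveI : HasExt.{max u v} A := HasExt.standard A
  ∀ ⦃X : A⦄, U X → ∀ e : Abelian.Ext.{max u v} X N 1, e = 0

/-- Right `U`-total acyclicity of a complex. Complexes are indexed cohomologically,
so that the object written `T_i` in homological notation is `T.X (-i)`, and its cycle object
is `T.cycles (-i)`. -/
structure IsTotallyAcyclic (U : ObjectProperty A) (T : CochainComplex A ℤ) : Prop where
  acyclic : T.Acyclic
  mem : ∀ n : ℤ, U (T.X n)
  cycles_mem : ∀ n : ℤ, rightOrthogonal U (T.cycles n)
  /-- For `W` in `U ∩ U^⊥`, the complex of abelian groups `Hom(T, W)` is acyclic. -/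
  hom_acyclic : ∀ W : A, U W → rightOrthogonal U W →
    (((preadditiveYoneda.obj W).mapHomologicalComplex _).obj T.op).Acyclic

/-- An object `M` is right `U`-Gorenstein if it is (isomorphic to) the object of
degree-`0` cycles of a right `U`-totally acyclic complex. -/
def gorenstein (U : ObjectProperty A) : ObjectProperty A := fun M =>
  ∃ T : CochainComplex A ℤ, IsTotallyAcyclic U T ∧ Nonempty (T.cycles 0 ≅ M)

instance (U : ObjectProperty A) : (gorenstein U).IsClosedUnderIsomorphisms where
  of_iso e := fun ⟨T, hT, ⟨e'⟩⟩ => ⟨T, hT, ⟨e' ≪≫ e⟩⟩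

section Ext

open Abelian

variable {U : ObjectProperty A}

lemma exists_lift {S : ShortComplex A} (hS : S.ShortExact)
    (h₁ : rightOrthogonal U S.X₁) {X : A} (hX : U X) (f : X ⟶ S.X₃) :
    ∃ g : X ⟶ S.X₂, g ≫ S.g = f := by
  have : HasExt.{max u v} A := HasExt.standard A
  obtain ⟨y, hy⟩ := Ext.covariant_sequence_exact₃ (n₁ := 1) X hS (Ext.mk₀ f) (zero_add 1)
    (h₁ hX _)
  obtain ⟨g, rfl⟩ := Ext.mk₀_bijective _ _ |>.2 y
  rw [Ext.mk₀_comp_mk₀] at hy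
  exact ⟨g, (Ext.mk₀_bijective _ _).1 hy⟩

lemma rightOrthogonal_of_lift {S : ShortComplex A} (hS : S.ShortExact)
    (h₂ : rightOrthogonal U S.X₂)
    (H : ∀ ⦃X : A⦄, U X → ∀ f : X ⟶ S.X₃, ∃ g : X ⟶ S.X₂, g ≫ S.g = f) :
    rightOrthogonal U S.X₁ := by
  have : HasExt.{max u v} A := HasExt.standard A
  intro X hX e
  obtain ⟨y, rfl⟩ := Ext.covariant_sequence_exact₁ X hS e (h₂ hX _) (zero_add 1)
  obtain ⟨f, rfl⟩ := Ext.mk₀_bijective _ _ |>.2 y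
  obtain ⟨g, rfl⟩ := H hX f
  rw [← Ext.mk₀_comp_mk₀, Ext.comp_assoc_of_second_deg_zero, hS.comp_extClass, Ext.comp_zero]

instance : (rightOrthogonal U).IsClosedUnderExtensions where
  prop_X₂_of_shortExact {S} hS h₁ h₃ X hX e := by
    have : HasExt.{max u v} A := HasExt.standard A
    obtain ⟨y, rfl⟩ := Ext.covariant_sequence_exact₂ X hS e (h₃ hX _)
    rw [h₁ hX y, Ext.zero_comp]

instance : (rightOrthogonal U).IsClosedUnderIsomorphisms where
  of_iso {Y Z} i h X hX e := by
    have : HasExt.{max u v} A := HasExt.standard A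
    have : e = (e.comp (Ext.mk₀ i.inv) (add_zero 1)).comp (Ext.mk₀ i.hom) (add_zero 1) := by
      rw [Ext.comp_assoc_of_second_deg_zero, Ext.mk₀_comp_mk₀]; simp
    rw [this, h hX (e.comp _ _), Ext.zero_comp]

lemma rightOrthogonal_of_isZero {Z : A} (hZ : IsZero Z) : rightOrthogonal U Z := by
  have : HasExt.{max u v} A := HasExt.standard A
  intro X hX e
  rw [← Ext.comp_mk₀_id e, hZ.eq_of_src (𝟙 Z) 0, Ext.mk₀_zero, Ext.comp_zero]

/-- If `Ext¹(X₃, W) = 0`, morphisms to `W` extend along `X₁ ⟶ X₂`. -/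
lemma exists_desc {S : ShortComplex A} (hS : S.ShortExact) {W : A}
    (h₃ : haveI : HasExt.{max u v} A := HasExt.standard A
      ∀ e : Ext.{max u v} S.X₃ W 1, e = 0) (f : S.X₁ ⟶ W) :
    ∃ g : S.X₂ ⟶ W, S.f ≫ g = f := by
  have : HasExt.{max u v} A := HasExt.standard A
  obtain ⟨y, hy⟩ := Ext.contravariant_sequence_exact₁ (n₁ := 1) hS W (Ext.mk₀ f) (add_zero 1)
    (h₃ _)
  obtain ⟨g, rfl⟩ := Ext.mk₀_bijective _ _ |>.2 y
  rw [Ext.mk₀_comp_mk₀] at hy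
  exact ⟨g, (Ext.mk₀_bijective _ _).1 hy⟩

lemma ext_eq_zero_of_desc {S : ShortComplex A} (hS : S.ShortExact) {W : A}
    (h₂ : haveI : HasExt.{max u v} A := HasExt.standard A
      ∀ e : Ext.{max u v} S.X₂ W 1, e = 0)
    (H : ∀ f : S.X₁ ⟶ W, ∃ g : S.X₂ ⟶ W, S.f ≫ g = f) :
    haveI : HasExt.{max u v} A := HasExt.standard A
    ∀ e : Ext.{max u v} S.X₃ W 1, e = 0 := by
  have : HasExt.{max u v} A := HasExt.standard A
  intro e
  obtain ⟨y, rfl⟩ := Ext.contravariant_sequence_exact₃ hS W e (h₂ _) (add_zero 1)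
  obtain ⟨f, rfl⟩ := Ext.mk₀_bijective _ _ |>.2 y
  obtain ⟨g, rfl⟩ := H f
  rw [← Ext.mk₀_comp_mk₀, hS.extClass_comp_assoc]

end Ext

section Cycles

/-- The sequence `0 ⟶ Zⁿ ⟶ Tⁿ ⟶ Zⁿ⁺¹ ⟶ 0`. -/
noncomputable abbrev cyclesSequence (T : CochainComplex A ℤ) (n m : ℤ) : ShortComplex A :=
  ShortComplex.mk (T.iCycles n) (T.toCycles n m) (by simp [← cancel_mono (T.iCycles m)])

lemma cyclesSequence_shortExact {T : CochainComplex A ℤ} (hT : T.Acyclic) (n m : ℤ)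
    (h : n + 1 = m) : (cyclesSequence T n m).ShortExact where
  exact := by
    rw [ShortComplex.exact_iff_exact_up_to_refinements]
    intro X (x : X ⟶ T.X n) (hx : x ≫ T.toCycles n m = 0)
    have hx' : x ≫ T.d n m = 0 := by
      rw [← T.toCycles_i, reassoc_of% hx, zero_comp]
    exact ⟨X, 𝟙 X, inferInstance, T.liftCycles x m (by simp [h]) hx', by simp⟩
  mono_f := by dsimp; infer_instance
  epi_g := by
    dsimp
    rw [epi_iff_surjective_up_to_refinements]
    intro X y
    obtain ⟨X', p, hp, x, hx⟩ :=
      (T.comp_homologyπ_eq_zero_iff_up_to_refinements n m (by simp [← h]) y).1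
        ((hT m).isZero_homology.eq_of_tgt _ _)
    exact ⟨X', p, hp, x, hx⟩

/-- Acyclicity of the complex of abelian groups `Hom(T, W)` in elementary terms. -/
lemma hom_acyclic_iff (T : CochainComplex A ℤ) (W : A) :
    (((preadditiveYoneda.obj W).mapHomologicalComplex _).obj T.op).Acyclic ↔
      ∀ (n m k : ℤ), n + 1 = m → m + 1 = k → ∀ f : T.X m ⟶ W, T.d n m ≫ f = 0 →
        ∃ g : T.X k ⟶ W, T.d m k ≫ g = f := by
  have key : ∀ n m k : ℤ, n + 1 = m → m + 1 = k →
      ((((preadditiveYoneda.obj W).mapHomologicalComplex _).obj T.op).ExactAt m ↔ 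
      ∀ f : T.X m ⟶ W, T.d n m ≫ f = 0 → ∃ g : T.X k ⟶ W, T.d m k ≫ g = f) := by
    intro n m k hn hk
    rw [HomologicalComplex.exactAt_iff' _ k m n (by subst hk; exact ComplexShape.prev_eq' _ (by simp)) (by subst hn; exact ComplexShape.next_eq' _ (by simp)),
      ShortComplex.ab_exact_iff]
    rfl
  constructor
  · intro h n m k hn hk
    exact (key n m k hn hk).1 (h m)
  · intro h m
    exact (key (m-1) m (m+1) (by simp) rfl).2 (h _ _ _ (by simp) rfl)

variable {U : ObjectProperty A}

namespace IsTotallyAcyclic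

variable {T : CochainComplex A ℤ}

lemma rightOrthogonal_X (hT : IsTotallyAcyclic U T) (n : ℤ) : rightOrthogonal U (T.X n) :=
  (rightOrthogonal U).prop_X₂_of_shortExact
    (cyclesSequence_shortExact hT.acyclic n (n + 1) rfl) (hT.cycles_mem _) (hT.cycles_mem _)

lemma exists_to (hT : IsTotallyAcyclic U T) (n m k : ℤ) (hn : n + 1 = m) (hm : m + 1 = k)
    {X : A} (hX : U X) (f : X ⟶ T.X m) (hf : f ≫ T.d m k = 0) :
    ∃ g : X ⟶ T.X n, g ≫ T.d n m = f := by
  obtain ⟨g, hg⟩ := exists_lift (cyclesSequence_shortExact hT.acyclic n m hn)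
    (hT.cycles_mem _) hX (T.liftCycles f k (by simp [hm]) hf)
  dsimp at g hg
  exact ⟨g, by rw [← T.toCycles_i, reassoc_of% hg, T.liftCycles_i]⟩

lemma exists_from (hT : IsTotallyAcyclic U T) (n m k : ℤ) (hn : n + 1 = m) (hm : m + 1 = k)
    {W : A} (hW : U W) (hW' : rightOrthogonal U W) (f : T.X m ⟶ W) (hf : T.d n m ≫ f = 0) :
    ∃ g : T.X k ⟶ W, T.d m k ≫ g = f :=
  (hom_acyclic_iff T W).1 (hT.hom_acyclic W hW hW') n m k hn hm f hf

lemma mk' (h₁ : T.Acyclic) (h₂ : ∀ n, U (T.X n)) (h₂' : ∀ n, rightOrthogonal U (T.X n))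
    (h₃ : ∀ (n m k : ℤ), n + 1 = m → m + 1 = k → ∀ {X : A}, U X → ∀ f : X ⟶ T.X m,
      f ≫ T.d m k = 0 → ∃ g : X ⟶ T.X n, g ≫ T.d n m = f)
    (h₄ : ∀ (n m k : ℤ), n + 1 = m → m + 1 = k → ∀ {W : A}, U W → rightOrthogonal U W →
      ∀ f : T.X m ⟶ W, T.d n m ≫ f = 0 → ∃ g : T.X k ⟶ W, T.d m k ≫ g = f) :
    IsTotallyAcyclic U T where
  acyclic := h₁
  mem := h₂
  cycles_mem n := by
    refine rightOrthogonal_of_lift (cyclesSequence_shortExact h₁ n (n + 1) rfl) (h₂' n) ?_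
    intro X hX (f : X ⟶ T.cycles (n + 1))
    obtain ⟨g, hg⟩ := h₃ n (n + 1) (n + 1 + 1) rfl rfl hX (f ≫ T.iCycles _) (by simp)
    exact ⟨g, by simpa [← cancel_mono (T.iCycles (n + 1))] using hg⟩
  hom_acyclic W hW hW' := (hom_acyclic_iff T W).2
    fun n m k hn hm f hf => h₄ n m k hn hm hW hW' f hf

lemma of_isZero [U.ContainsZero] [U.IsClosedUnderIsomorphisms]
    {T : CochainComplex A ℤ} (hT : ∀ n, IsZero (T.X n)) : IsTotallyAcyclic U T :=
  mk' (fun n => .of_isZero (hT n)) (fun n => U.prop_of_isZero (hT n))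
    (fun n => rightOrthogonal_of_isZero (hT n))
    (fun _ _ _ _ _ _ _ _ _ => ⟨0, (hT _).eq_of_tgt _ _⟩)
    (fun _ _ _ _ _ _ _ _ _ _ => ⟨0, (hT _).eq_of_src _ _⟩)

lemma shift (hT : IsTotallyAcyclic U T) (a : ℤ) : IsTotallyAcyclic U (T⟦a⟧) := by
  refine mk' ?_ (fun n => hT.mem _) (fun n => hT.rightOrthogonal_X _) ?_ ?_
  · have h := (HomotopyCategory.quotient_obj_mem_subcategoryAcyclic_iff_acyclic T).2 hT.acyclic
    have h' := (HomotopyCategory.subcategoryAcyclic A).le_shift a _ h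
    exact (HomotopyCategory.quotient_obj_mem_subcategoryAcyclic_iff_acyclic _).1
      ((HomotopyCategory.subcategoryAcyclic A).prop_of_iso
        (((HomotopyCategory.quotient A (ComplexShape.up ℤ)).commShiftIso a).app T).symm h')
  · intro n m k hn hm X hX (f : X ⟶ T.X (m + a)) hf
    have hf' : f ≫ T.d (m + a) (k + a) = 0 := by
      rw [CochainComplex.shiftFunctor_obj_d'] at hf
      obtain h | h := Int.units_eq_one_or a.negOnePow
      · rw [h, one_smul] at hf; exact hf
      · rw [h, Units.neg_smul, one_smul] at hf
        exact neg_eq_zero.1 ((Preadditive.comp_neg _ _).symm.trans hf)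
    obtain ⟨g, hg⟩ := hT.exists_to (n + a) (m + a) (k + a) (by lia) (by lia) hX f hf'
    obtain h | h := Int.units_eq_one_or a.negOnePow
    · exact ⟨g, by rw [CochainComplex.shiftFunctor_obj_d', h, one_smul]; exact hg⟩
    · refine ⟨-g, ?_⟩
      rw [CochainComplex.shiftFunctor_obj_d', h, Units.neg_smul, one_smul]
      exact (Preadditive.neg_comp_neg _ _).trans hg
  · intro n m k hn hm W hW hW' (f : T.X (m + a) ⟶ W) hf
    have hf' : T.d (n + a) (m + a) ≫ f = 0 := by
      rw [CochainComplex.shiftFunctor_obj_d'] at hf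
      obtain h | h := Int.units_eq_one_or a.negOnePow
      · rw [h, one_smul] at hf; exact hf
      · rw [h, Units.neg_smul, one_smul] at hf
        exact neg_eq_zero.1 ((Preadditive.neg_comp _ _).symm.trans hf)
    obtain ⟨g, hg⟩ := hT.exists_from (n + a) (m + a) (k + a) (by lia) (by lia) hW hW' f hf'
    obtain h | h := Int.units_eq_one_or a.negOnePow
    · exact ⟨g, by rw [CochainComplex.shiftFunctor_obj_d', h, one_smul]; exact hg⟩
    · refine ⟨-g, ?_⟩
      rw [CochainComplex.shiftFunctor_obj_d', h, Units.neg_smul, one_smul]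
      exact (Preadditive.neg_comp_neg _ _).trans hg

open CochainComplex in
lemma cone [U.IsClosedUnderFiniteProducts] [U.IsClosedUnderIsomorphisms]
    {T' : CochainComplex A ℤ} (hT : IsTotallyAcyclic U T)
    (hT' : IsTotallyAcyclic U T') (φ : T ⟶ T') :
    IsTotallyAcyclic U (mappingCone φ) := by
  have e (n : ℤ) : (mappingCone φ).X n ≅ T.X (n + 1) ⊞ T'.X n :=
    HomologicalComplex.homotopyCofiber.XIsoBiprod φ n (n + 1) rfl
  refine mk' ?_ (fun n => U.prop_of_iso ((biprod.isoProd _ _).symm ≪≫ (e n).symm) ?_)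
      (fun n => (rightOrthogonal U).prop_of_iso (e n).symm ?_) ?_ ?_
  · have h := (HomotopyCategory.quotient_obj_mem_subcategoryAcyclic_iff_acyclic T).2 hT.acyclic
    have h' := (HomotopyCategory.quotient_obj_mem_subcategoryAcyclic_iff_acyclic T').2 hT'.acyclic
    exact (HomotopyCategory.quotient_obj_mem_subcategoryAcyclic_iff_acyclic _).1
      ((HomotopyCategory.subcategoryAcyclic A).ext_of_isTriangulatedClosed₃ _
        (HomotopyCategory.mappingCone_triangleh_distinguished φ) h h')
  · exact U.prop_prod _ _ (hT.mem _) (hT'.mem _)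
  · exact (rightOrthogonal U).prop_biprod (hT.rightOrthogonal_X _) (hT'.rightOrthogonal_X _)
  · intro n m k hn hm X hX f hf
    have hf₁ : (f ≫ (mappingCone.fst φ).1.v m k hm) ≫ T.d k (k + 1) = 0 := by
      have := mappingCone.d_fst_v φ m k (k + 1) hm rfl
      have h : f ≫ _ = f ≫ _ := congrArg (f ≫ ·) this
      rw [reassoc_of% hf, zero_comp, Preadditive.comp_neg] at h
      rw [Category.assoc]
      exact neg_eq_zero.1 h.symm
    obtain ⟨a, ha⟩ := hT.exists_to m k (k + 1) hm rfl hX _ hf₁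
    have ha' : (f + a ≫ (mappingCone.inl φ).v m n (by lia) ≫ (mappingCone φ).d n m) ≫
        (mappingCone.fst φ).1.v m k hm = 0 := by
      simp [mappingCone.d_fst_v φ n m k hn hm, ha]
    obtain ⟨a', b, hab⟩ := mappingCone.decomp_to φ
      (f + a ≫ (mappingCone.inl φ).v m n (by lia) ≫ (mappingCone φ).d n m) k hm
    obtain rfl : a' = 0 := by simpa [hab] using ha'
    rw [zero_comp, zero_add] at hab
    have hb : b ≫ T'.d m k = 0 := by
      have h := congrArg (· ≫ (mappingCone φ).d m k ≫
        (mappingCone.snd φ).v k k (add_zero k)) hab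
      simpa [reassoc_of% hf] using h.symm
    obtain ⟨c, hc⟩ := hT'.exists_to n m k hn hm hX b hb
    refine ⟨c ≫ (mappingCone.inr φ).f n - a ≫ (mappingCone.inl φ).v m n (by lia), ?_⟩
    rw [Preadditive.sub_comp, Category.assoc, mappingCone.inr_f_d, reassoc_of% hc, ← hab]
    simp
  · intro n m k hn hm W hW hW' f hf
    have hf₁ : T'.d n m ≫ (mappingCone.inr φ).f m ≫ f = 0 := by
      rw [← mappingCone.inr_f_d_assoc, hf, comp_zero]
    obtain ⟨b, hb⟩ := hT'.exists_from n m k hn hm hW hW' _ hf₁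
    obtain ⟨a, b', hab⟩ := mappingCone.decomp_from φ
      (f - (mappingCone φ).d m k ≫ (mappingCone.snd φ).v k k (add_zero k) ≫ b) k hm
    have hb' : b' = 0 := by
      have h := congrArg ((mappingCone.inr φ).f m ≫ ·) hab
      simpa [hb, mappingCone.inr_f_d_assoc] using h.symm
    subst hb'
    rw [comp_zero, add_zero] at hab
    have ha : T.d m k ≫ a = 0 := by
      have h := congrArg ((mappingCone.inl φ).v m n (by lia) ≫ (mappingCone φ).d n m ≫ ·) hab
      simpa [reassoc_of% hf, hf, mappingCone.d_fst_v_assoc φ n m k hn hm] using h.symm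
    obtain ⟨c, hc⟩ := hT.exists_from m k (k + 1) hm rfl hW hW' a ha
    refine ⟨(mappingCone.snd φ).v k k (add_zero k) ≫ b - (mappingCone.fst φ).1.v k (k + 1) rfl ≫ c,
      ?_⟩
    rw [Preadditive.comp_sub, mappingCone.d_fst_v_assoc φ m k (k + 1) hm rfl, Preadditive.neg_comp,
      Category.assoc, hc, ← hab]
    simp

open HomologicalComplex in
lemma biprod [U.IsClosedUnderFiniteProducts] [U.IsClosedUnderIsomorphisms]
    {T' : CochainComplex A ℤ} (hT : IsTotallyAcyclic U T) (hT' : IsTotallyAcyclic U T') :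
    IsTotallyAcyclic U (T ⊞ T') := by
  refine mk' ?_
      (fun n => U.prop_of_iso ((biprod.isoProd _ _).symm ≪≫ (biprodXIso T T' n).symm)
        (U.prop_prod _ _ (hT.mem _) (hT'.mem _)))
      (fun n => (rightOrthogonal U).prop_of_iso (biprodXIso T T' n).symm
        ((rightOrthogonal U).prop_biprod (hT.rightOrthogonal_X _) (hT'.rightOrthogonal_X _))) ?_ ?_
  · intro n
    rw [exactAt_iff_isZero_homology]
    have := preservesBinaryBiproducts_of_preservesBiproducts
      (homologyFunctor A (ComplexShape.up ℤ) n)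
    refine IsZero.of_iso ?_ ((homologyFunctor A (ComplexShape.up ℤ) n).mapBiprod T T')
    rw [biprod_isZero_iff]
    exact ⟨(hT.acyclic n).isZero_homology, (hT'.acyclic n).isZero_homology⟩
  · intro n m k hn hm X hX f hf
    obtain ⟨a, ha⟩ := hT.exists_to n m k hn hm hX (f ≫ (biprod.fst : T ⊞ T' ⟶ T).f m)
      (by rw [Category.assoc, Hom.comm, reassoc_of% hf, zero_comp])
    obtain ⟨b, hb⟩ := hT'.exists_to n m k hn hm hX (f ≫ (biprod.snd : T ⊞ T' ⟶ T').f m)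
      (by rw [Category.assoc, Hom.comm, reassoc_of% hf, zero_comp])
    refine ⟨a ≫ (biprod.inl : T ⟶ T ⊞ T').f n + b ≫ (biprod.inr : T' ⟶ T ⊞ T').f n, ?_⟩
    rw [Preadditive.add_comp, Category.assoc, Category.assoc, Hom.comm, Hom.comm,
      reassoc_of% ha, reassoc_of% hb, ← Preadditive.comp_add, biprod_total_f, Category.comp_id]
  · intro n m k hn hm W hW hW' f hf
    obtain ⟨a, ha⟩ := hT.exists_from n m k hn hm hW hW' ((biprod.inl : T ⟶ T ⊞ T').f m ≫ f)
      (by rw [← Hom.comm_assoc, hf, comp_zero])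
    obtain ⟨b, hb⟩ := hT'.exists_from n m k hn hm hW hW' ((biprod.inr : T' ⟶ T ⊞ T').f m ≫ f)
      (by rw [← Hom.comm_assoc, hf, comp_zero])
    refine ⟨(biprod.fst : T ⊞ T' ⟶ T).f k ≫ a + (biprod.snd : T ⊞ T' ⟶ T').f k ≫ b, ?_⟩
    rw [Preadditive.comp_add, ← Hom.comm_assoc, ← Hom.comm_assoc, ha, hb,
      ← Category.assoc, ← Category.assoc, ← Preadditive.add_comp, biprod_total_f, Category.id_comp]

end IsTotallyAcyclic

open HomologicalComplex in
/-- Objects of `U ∩ U^⊥` are right `U`-Gorenstein. -/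
lemma gorenstein_of_mem [U.ContainsZero] [U.IsClosedUnderIsomorphisms] {W : A} (hW : U W)
    (hW' : rightOrthogonal U W) : gorenstein U W := by
  have h₀₁ : (ComplexShape.up ℤ).Rel (-1) 0 := by simp
  let T : CochainComplex A ℤ := double (𝟙 W) h₀₁
  have hz (n : ℤ) (h₀ : n ≠ -1) (h₁ : n ≠ 0) : IsZero (T.X n) := isZero_double_X _ _ n h₀ h₁
  let e₀ : T.X (-1) ≅ W := doubleXIso₀ _ h₀₁
  let e₁ : T.X 0 ≅ W := doubleXIso₁ _ h₀₁ (by simp)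
  have hd : T.d (-1) 0 = e₀.hom ≫ e₁.inv := by
    simpa using double_d (𝟙 W) h₀₁ (by simp)
  have : IsIso (T.d (-1) 0) := by rw [hd]; infer_instance
  have hd0 (n m : ℤ) (hn : n ≠ -1) : T.d n m = 0 := double_d_eq_zero₀ _ _ _ _ hn
  have hd1 (n m : ℤ) (hm : m ≠ 0) : T.d n m = 0 := double_d_eq_zero₁ _ _ _ _ hm
  have key (P : ObjectProperty A) [P.IsClosedUnderIsomorphisms] (hP : P W)
      (h0 : ∀ Z, IsZero Z → P Z) (n : ℤ) : P (T.X n) := by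
    by_cases h₀ : n = -1
    · subst h₀; exact P.prop_of_iso e₀.symm hP
    · by_cases h₁ : n = 0
      · subst h₁; exact P.prop_of_iso e₁.symm hP
      · exact h0 _ (hz n h₀ h₁)
  have hto (n m k : ℤ) (hn : n + 1 = m) (hm : m + 1 = k) {X : A} (f : X ⟶ T.X m)
      (hf : f ≫ T.d m k = 0) : ∃ g : X ⟶ T.X n, g ≫ T.d n m = f := by
    by_cases h₀ : m = -1
    · obtain rfl : k = 0 := by lia
      subst h₀
      have hf0 : f = 0 := by rw [← cancel_mono (T.d (-1) 0), hf, zero_comp]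
      exact ⟨0, by rw [hf0, zero_comp]⟩
    · by_cases h₁ : m = 0
      · obtain rfl : n = -1 := by lia
        subst h₁
        exact ⟨f ≫ inv (T.d (-1) 0), by simp⟩
      · exact ⟨0, (hz m h₀ h₁).eq_of_tgt _ _⟩
  refine ⟨T, .mk' (fun n => ?_) (key U hW fun Z hZ => U.prop_of_isZero hZ)
    (key (rightOrthogonal U) hW' fun Z hZ => rightOrthogonal_of_isZero hZ)
    (fun n m k hn hm X hX f hf => hto n m k hn hm f hf) ?_, ⟨?_⟩⟩
  · rw [exactAt_iff' _ (n - 1) n (n + 1) (by simp) (by simp),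
      ShortComplex.exact_iff_exact_up_to_refinements]
    intro X x hx
    obtain ⟨g, hg⟩ := hto (n - 1) n (n + 1) (by simp) rfl x hx
    exact ⟨X, 𝟙 X, inferInstance, g, (Category.id_comp _).trans hg.symm⟩
  · intro n m k hn hm V hV hV' f hf
    by_cases h₀ : m = -1
    · obtain rfl : k = 0 := by lia
      subst h₀
      exact ⟨inv (T.d (-1) 0) ≫ f, by simp⟩
    · by_cases h₁ : m = 0
      · obtain rfl : n = -1 := by lia
        subst h₁
        have hf0 : f = 0 := by rw [← cancel_epi (T.d (-1) 0), hf, comp_zero]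
        exact ⟨0, by rw [hf0, comp_zero]⟩
      · exact ⟨0, (hz m h₀ h₁).eq_of_src _ _⟩
  · have : T.d 0 1 = 0 := hd0 _ _ (by simp)
    exact (T.iCyclesIso 0 1 (by simp) this) ≪≫ e₁

lemma gorenstein_X [U.ContainsZero] [U.IsClosedUnderIsomorphisms] {T : CochainComplex A ℤ}
    (hT : IsTotallyAcyclic U T) (n : ℤ) : gorenstein U (T.X n) :=
  gorenstein_of_mem (hT.mem n) (hT.rightOrthogonal_X n)

instance [U.IsClosedUnderFiniteProducts] : U.ContainsZero where
  exists_zero := ⟨⊤_ A, (isZero_zero A).of_iso (HasZeroObject.zeroIsoTerminal).symm,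
    U.prop_terminal⟩

instance [U.ContainsZero] [U.IsClosedUnderIsomorphisms] : (gorenstein U).ContainsZero where
  exists_zero := ⟨0, isZero_zero A,
    gorenstein_of_mem (U.prop_of_isZero (isZero_zero A))
      (rightOrthogonal_of_isZero (isZero_zero A))⟩

instance [U.IsClosedUnderFiniteProducts] [U.IsClosedUnderIsomorphisms] :
    (gorenstein U).IsClosedUnderBinaryProducts where
  limitsOfShape_le := by
    rintro X ⟨p⟩
    obtain ⟨T, hT, ⟨e⟩⟩ := p.prop_diag_obj (.mk .left)
    obtain ⟨T', hT', ⟨e'⟩⟩ := p.prop_diag_obj (.mk .right)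
    have : (HomologicalComplex.cyclesFunctor A (ComplexShape.up ℤ) 0).Additive := 
      ⟨fun {_ _ f g} => by
        change HomologicalComplex.cyclesMap (f + g) 0 =
          HomologicalComplex.cyclesMap f 0 + HomologicalComplex.cyclesMap g 0
        rw [← cancel_mono (HomologicalComplex.iCycles _ _)]
        simp⟩
    have := preservesBinaryBiproducts_of_preservesBiproducts
      (HomologicalComplex.cyclesFunctor A (ComplexShape.up ℤ) 0)
    exact ⟨T ⊞ T', hT.biprod hT',
      ⟨(HomologicalComplex.cyclesFunctor A (ComplexShape.up ℤ) 0).mapBiprod T T' ≪≫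
        biprod.mapIso e e' ≪≫ biprod.isoProd _ _ ≪≫
        IsLimit.conePointUniqueUpToIso (prodIsProd _ _)
          ((IsLimit.postcomposeHomEquiv (diagramIsoPair p.diag) _).2 p.isLimit)⟩⟩

instance [U.IsClosedUnderFiniteProducts] [U.IsClosedUnderIsomorphisms] :
    (gorenstein U).IsClosedUnderFiniteProducts := .mk'

/-- The objects of the homotopy category given by right `U`-totally acyclic
complexes. -/
def totallyAcyclic (U : ObjectProperty A) :
    ObjectProperty (HomotopyCategory A (ComplexShape.up ℤ)) :=
  fun T => IsTotallyAcyclic U T.as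

lemma IsTotallyAcyclic.shift_totallyAcyclic {T : HomotopyCategory A (ComplexShape.up ℤ)}
    (hT : IsTotallyAcyclic U T.as) (a : ℤ) : totallyAcyclic U (T⟦a⟧) := by
  have h : T⟦a⟧ = (HomotopyCategory.quotient _ _).obj
      ((shiftFunctor (CochainComplex A ℤ) a).obj T.as) :=
    HomotopyCategory.shift_quotient_obj T.as a
  rw [h]
  exact hT.shift a

open Pretriangulated in
instance [U.IsClosedUnderFiniteProducts] [U.IsClosedUnderIsomorphisms] :
    (totallyAcyclic U).IsTriangulated where
  exists_zero := ⟨(HomotopyCategory.quotient _ _).obj 0,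
    (HomotopyCategory.quotient _ _).map_isZero (isZero_zero _),
    IsTotallyAcyclic.of_isZero fun n =>
      (HomologicalComplex.eval A (ComplexShape.up ℤ) n).map_isZero (isZero_zero _)⟩
  isStableUnderShiftBy a :=
    { le_shift := fun _ hT => hT.shift_totallyAcyclic a }
  ext₂' := by
    have : (totallyAcyclic U).IsStableUnderShift ℤ :=
      ⟨fun a => ⟨fun _ hT => hT.shift_totallyAcyclic a⟩⟩
    have : (totallyAcyclic U).IsTriangulatedClosed₃ := ⟨by
      rintro T hT (h₁ : IsTotallyAcyclic U T.obj₁.as) (h₂ : IsTotallyAcyclic U T.obj₂.as)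
      let φ : T.obj₁.as ⟶ T.obj₂.as := T.mor₁.out
      have hφ : (HomotopyCategory.quotient A (ComplexShape.up ℤ)).map φ = T.mor₁ :=
        HomotopyCategory.quotient_map_out _
      obtain ⟨e, -, -⟩ := exists_iso_of_arrow_iso _ _ hT
        (HomotopyCategory.mappingCone_triangleh_distinguished φ)
        (Arrow.isoMk (Iso.refl _) (Iso.refl _)
          (((Category.id_comp _).trans hφ).trans (Category.comp_id _).symm))
      exact ⟨_, h₁.cone h₂ φ, ⟨Triangle.π₃.mapIso e⟩⟩⟩
    exact (ObjectProperty.IsTriangulatedClosed₂.of_isTriangulatedClosed₃).ext₂'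

end Cycles

section Frobenius

variable (P : ObjectProperty A)

/-- The conflations of the full subcategory `P`, for the exact structure inherited from the
ambient abelian category. -/
def IsConflation (S : ShortComplex P.FullSubcategory) : Prop := (S.map P.ι).ShortExact

/-- Projective objects of the exact category `P`. -/
def IsRelProjective (I : P.FullSubcategory) : Prop :=
  ∀ S : ShortComplex P.FullSubcategory, IsConflation P S →
    ∀ f : I ⟶ S.X₃, ∃ g : I ⟶ S.X₂, g ≫ S.g = f

/-- Injective objects of the exact category `P`. -/
def IsRelInjective (I : P.FullSubcategory) : Prop :=
  ∀ S : ShortComplex P.FullSubcategory, IsConflation P S →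
    ∀ f : S.X₁ ⟶ I, ∃ g : S.X₂ ⟶ I, S.f ≫ g = f

/-- The full subcategory `P` of the abelian category, with its conflations, is a Frobenius exact
category. -/
structure IsFrobenius : Prop where
  additive : P.IsClosedUnderFiniteProducts
  closedUnderExtensions : P.IsClosedUnderExtensions
  enough_projectives : ∀ X : P.FullSubcategory, ∃ S : ShortComplex P.FullSubcategory,
    IsConflation P S ∧ IsRelProjective P S.X₂ ∧ Nonempty (S.X₃ ≅ X)
  enough_injectives : ∀ X : P.FullSubcategory, ∃ S : ShortComplex P.FullSubcategory,
    IsConflation P S ∧ IsRelInjective P S.X₂ ∧ Nonempty (S.X₁ ≅ X)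
  projective_iff_injective : ∀ I : P.FullSubcategory, IsRelProjective P I ↔ IsRelInjective P I

/-- Two morphisms are identified in the stable category if their difference factors through a
projective-injective object. -/
def stableRel : HomRel P.FullSubcategory := fun X Y f g =>
  ∃ (I : P.FullSubcategory) (a : X ⟶ I) (b : I ⟶ Y),
    IsRelProjective P I ∧ IsRelInjective P I ∧ a ≫ b = f - g

/-- The stable category of `P`. -/
def StableCategory := CategoryTheory.Quotient (stableRel P)

noncomputable instance : Category (StableCategory P) :=
  inferInstanceAs (Category (CategoryTheory.Quotient (stableRel P)))

/-- The projection from `P` to its stable category. -/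
def stableQuotient : P.FullSubcategory ⥤ StableCategory P :=
  CategoryTheory.Quotient.functor (stableRel P)

variable {P} in
lemma stableQuotient_map_eq {X Y : P.FullSubcategory} {f g : X ⟶ Y} (h : stableRel P f g) :
    (stableQuotient P).map f = (stableQuotient P).map g :=
  CategoryTheory.Quotient.sound _ h

variable [P.IsClosedUnderFiniteProducts]

instance : HasBinaryBiproducts P.FullSubcategory := HasBinaryBiproducts.of_hasBinaryProducts

variable {P}

lemma stableRel_add {X Y : P.FullSubcategory} {f₁ f₂ g₁ g₂ : X ⟶ Y}
    (h : stableRel P f₁ f₂) (h' : stableRel P g₁ g₂) : stableRel P (f₁ + g₁) (f₂ + g₂) := by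
  obtain ⟨I, a, b, hI₁, hI₂, hab⟩ := h
  obtain ⟨J, c, d, hJ₁, hJ₂, hcd⟩ := h'
  refine ⟨I ⊞ J, biprod.lift a c, biprod.desc b d, ?_, ?_, ?_⟩
  · intro S hS f
    obtain ⟨g₁, hg₁⟩ := hI₁ S hS (biprod.inl ≫ f)
    obtain ⟨g₂, hg₂⟩ := hJ₁ S hS (biprod.inr ≫ f)
    exact ⟨biprod.desc g₁ g₂, biprod.hom_ext' _ _ (by simp [hg₁]) (by simp [hg₂])⟩
  · intro S hS f
    obtain ⟨g₁, hg₁⟩ := hI₂ S hS (f ≫ biprod.fst)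
    obtain ⟨g₂, hg₂⟩ := hJ₂ S hS (f ≫ biprod.snd)
    exact ⟨biprod.lift g₁ g₂, biprod.hom_ext _ _ (by simp [hg₁]) (by simp [hg₂])⟩
  · rw [biprod.lift_desc, hab, hcd]; abel

lemma stableRel_refl {X Y : P.FullSubcategory} (f : X ⟶ Y) : stableRel P f f :=
  ⟨0, 0, 0, fun _ _ _ => ⟨0, (isZero_zero _).eq_of_src _ _⟩,
    fun _ _ _ => ⟨0, (isZero_zero _).eq_of_tgt _ _⟩, by simp⟩

instance : Congruence (stableRel P) where
  equivalence :=
    { refl := stableRel_refl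
      symm := by
        rintro f g ⟨I, a, b, h₁, h₂, h⟩
        exact ⟨I, -a, b, h₁, h₂, by rw [Preadditive.neg_comp, h]; abel⟩
      trans := by
        intro f g h hfg hgh
        have := stableRel_add (stableRel_add hfg hgh) (stableRel_refl (-g))
        convert! this using 1 <;> abel }
  comp_left := by
    rintro X Y Z f g g' ⟨I, a, b, h₁, h₂, h⟩
    exact ⟨I, f ≫ a, b, h₁, h₂, by rw [Category.assoc, h, Preadditive.comp_sub]⟩
  comp_right := by
    rintro X Y Z f f' g ⟨I, a, b, h₁, h₂, h⟩
    exact ⟨I, a, b ≫ g, h₁, h₂, by rw [reassoc_of% h, Preadditive.sub_comp]⟩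

variable (P)

noncomputable instance : Preadditive (StableCategory P) :=
  CategoryTheory.Quotient.preadditive (stableRel P) (fun _ _ _ _ _ _ h h' => stableRel_add h h')

instance : (stableQuotient P).Additive := ⟨rfl⟩

instance : HasZeroObject (StableCategory P) :=
  ⟨(stableQuotient P).obj 0, (stableQuotient P).map_isZero (isZero_zero _)⟩

open Pretriangulated in
/-- A pretriangulated structure on the stable category of a Frobenius category `P` is the standard
one if there are connecting morphisms `δ_S : X₃ ⟶ X₁⟦1⟧` in the stable category, one for each
conflation `S = (X₁ ⟶ X₂ ⟶ X₃)`, natural with respect to morphisms of conflations, such that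
* whenever `X₂` is injective, `δ_S` is an isomorphism (so that `X₁⟦1⟧` is the cosyzygy of `X₁`,
  and for an arbitrary conflation `δ_S` is obtained from a morphism from `S` to a
  conflation `X₁ ⟶ I ⟶ X₁⟦1⟧` with `I` injective, by naturality);
* the distinguished triangles are, up to isomorphism, the triangles
  `X₁ ⟶ X₂ ⟶ X₃ ⟶ X₁⟦1⟧` given by the conflations of `P` and the connecting morphisms `δ_S`. -/
def IsStandardTriangulation [HasShift (StableCategory P) ℤ]
    [∀ n : ℤ, (shiftFunctor (StableCategory P) n).Additive]
    [Pretriangulated (StableCategory P)] : Prop :=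
  ∃ δ : ∀ (S : ShortComplex P.FullSubcategory), IsConflation P S →
      ((stableQuotient P).obj S.X₃ ⟶ ((stableQuotient P).obj S.X₁)⟦(1 : ℤ)⟧),
    (∀ (S S' : ShortComplex P.FullSubcategory) (hS : IsConflation P S) (hS' : IsConflation P S')
      (φ : S ⟶ S'), (stableQuotient P).map φ.τ₃ ≫ δ S' hS' =
        δ S hS ≫ ((stableQuotient P).map φ.τ₁)⟦(1 : ℤ)⟧') ∧
    (∀ (S : ShortComplex P.FullSubcategory) (hS : IsConflation P S),
      IsRelInjective P S.X₂ → IsIso (δ S hS)) ∧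
    (∀ t : Triangle (StableCategory P), t ∈ distTriang (StableCategory P) ↔
      ∃ (S : ShortComplex P.FullSubcategory) (hS : IsConflation P S),
        Nonempty (t ≅ Triangle.mk ((stableQuotient P).map S.f) ((stableQuotient P).map S.g)
          (δ S hS)))

end Frobenius

section Cycles

variable (U : ObjectProperty A)

lemma isRelProjective_of_mem (I : (gorenstein U).FullSubcategory) (hI : U I.obj) :
    IsRelProjective (gorenstein U) I := by
  intro S hS f
  obtain ⟨T, hT, ⟨e⟩⟩ := S.X₁.property
  obtain ⟨g, hg⟩ := exists_lift hS ((rightOrthogonal U).prop_of_iso e (hT.cycles_mem 0)) hI f.hom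
  exact ⟨ObjectProperty.homMk g, by ext; exact hg⟩

lemma isRelInjective_of_mem (I : (gorenstein U).FullSubcategory) (hI : U I.obj)
    (hI' : rightOrthogonal U I.obj) : IsRelInjective (gorenstein U) I := by
  intro S hS f
  obtain ⟨T, hT, ⟨e⟩⟩ := S.X₃.property
  have h := ext_eq_zero_of_desc (cyclesSequence_shortExact hT.acyclic (-1) 0 (by simp))
    (hI' (hT.mem (-1))) (fun (f : T.cycles (-1) ⟶ I.obj) => by
      obtain ⟨g, hg⟩ := hT.exists_from (-3) (-2) (-1) (by simp) (by simp) hI hI'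
        (T.toCycles (-2) (-1) ≫ f) (by simp)
      have : Epi (T.toCycles (-2) (-1)) :=
        (cyclesSequence_shortExact hT.acyclic (-2) (-1) (by simp)).epi_g
      refine ⟨g, ?_⟩
      rw [← cancel_epi (T.toCycles (-2) (-1)), ← hg]
      simp)
  have h' : haveI : HasExt.{max u v} A := HasExt.standard A
      ∀ x : Abelian.Ext.{max u v} S.X₃.obj I.obj 1, x = 0 := by
    have : HasExt.{max u v} A := HasExt.standard A
    intro x
    have hx : x = (Abelian.Ext.mk₀ e.inv).comp
        ((Abelian.Ext.mk₀ e.hom).comp x (zero_add 1)) (zero_add 1) := by simp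
    rw [hx, h ((Abelian.Ext.mk₀ e.hom).comp x (zero_add 1)), Abelian.Ext.comp_zero]
  obtain ⟨g, hg⟩ := exists_desc hS h' f.hom
  exact ⟨ObjectProperty.homMk g, by ext; exact hg⟩

variable [U.IsClosedUnderFiniteProducts] [U.IsClosedUnderIsomorphisms]

lemma stableRel_cyclesMap {T T' : CochainComplex A ℤ} (hT : IsTotallyAcyclic U T)
    (hT' : IsTotallyAcyclic U T') {φ ψ : T ⟶ T'} (h : Homotopy φ ψ) :
    stableRel (gorenstein U) (X := ⟨T.cycles 0, T, hT, ⟨Iso.refl _⟩⟩)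
      (Y := ⟨T'.cycles 0, T', hT', ⟨Iso.refl _⟩⟩)
      (ObjectProperty.homMk (HomologicalComplex.cyclesMap φ 0))
      (ObjectProperty.homMk (HomologicalComplex.cyclesMap ψ 0)) := by
  refine ⟨⟨T'.X (-1), gorenstein_X hT' _⟩,
    ObjectProperty.homMk (T.iCycles 0 ≫ h.hom 0 (-1)), ObjectProperty.homMk (T'.toCycles (-1) 0),
    isRelProjective_of_mem _ _ (hT'.mem _),
    isRelInjective_of_mem _ _ (hT'.mem _) (hT'.rightOrthogonal_X _), ?_⟩
  ext
  have h₀ := h.comm 0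
  rw [dNext_eq h.hom (show (ComplexShape.up ℤ).Rel 0 1 by simp),
    prevD_eq h.hom (show (ComplexShape.up ℤ).Rel (-1) 0 by simp)] at h₀
  change (T.iCycles 0 ≫ h.hom 0 (-1)) ≫ T'.toCycles (-1) 0 =
    HomologicalComplex.cyclesMap φ 0 - HomologicalComplex.cyclesMap ψ 0
  rw [← cancel_mono (T'.iCycles 0)]
  simp [h₀]

/-- The functor of degree-`0` cycles, from the homotopy category of right `U`-totally
acyclic complexes to the stable category of right `U`-Gorenstein objects: it sends `T` to `Z₀(T)`
and the homotopy class of `φ` to the stable class of `Z₀(φ)`. -/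
noncomputable def cyclesZero :
    (totallyAcyclic U).FullSubcategory ⥤ StableCategory (gorenstein U) where
  obj T := (stableQuotient (gorenstein U)).obj
    ⟨T.obj.as.cycles 0, T.obj.as, T.property, ⟨Iso.refl _⟩⟩
  map {T T'} f := (stableQuotient (gorenstein U)).map
    (ObjectProperty.homMk (HomologicalComplex.cyclesMap f.hom.out 0))
  map_id T := by
    have h : (HomotopyCategory.quotient A (ComplexShape.up ℤ)).map (𝟙 T : T ⟶ T).hom.out =
        (HomotopyCategory.quotient A (ComplexShape.up ℤ)).map (𝟙 T.obj.as) :=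
      (HomotopyCategory.quotient_map_out (𝟙 T : T ⟶ T).hom).trans
        ((HomotopyCategory.quotient A (ComplexShape.up ℤ)).map_id T.obj.as).symm
    rw [stableQuotient_map_eq (stableRel_cyclesMap U T.property T.property
      (HomotopyCategory.homotopyOfEq _ _ h)), HomologicalComplex.cyclesMap_id]
    exact (stableQuotient (gorenstein U)).map_id _
  map_comp {T₁ T₂ T₃} f g := by
    have h : (HomotopyCategory.quotient A (ComplexShape.up ℤ)).map (f ≫ g).hom.out =
        (HomotopyCategory.quotient A (ComplexShape.up ℤ)).map (f.hom.out ≫ g.hom.out) := by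
      rw [HomotopyCategory.quotient_map_out_comp_out]
      exact HomotopyCategory.quotient_map_out _
    rw [stableQuotient_map_eq (stableRel_cyclesMap U T₁.property T₃.property
      (HomotopyCategory.homotopyOfEq _ _ h)), ← Functor.map_comp]
    congr 1
    ext
    exact HomologicalComplex.cyclesMap_comp _ _ _

/-- The functor `cyclesZero` sends the homotopy class of `φ` to the stable class of `Z₀(φ)`. -/
lemma cyclesZero_map {T T' : (totallyAcyclic U).FullSubcategory} (φ : T.obj.as ⟶ T'.obj.as) :
    (cyclesZero U).map (ObjectProperty.homMk ((HomotopyCategory.quotient A _).map φ) : T ⟶ T') =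
      (stableQuotient (gorenstein U)).map
        (ObjectProperty.homMk (HomologicalComplex.cyclesMap φ 0)) :=
  stableQuotient_map_eq (stableRel_cyclesMap U T.property T'.property
    (HomotopyCategory.homotopyOutMap φ))

end Cycles

section Resolutions

variable (U : ObjectProperty A)

/-- A choice, for each right `U`-Gorenstein object `M`, of a right `U`-totally acyclic complex `T`
with `Z₀(T) = M` (through a given isomorphism). -/
structure ResolutionChoice where
  complex : (gorenstein U).FullSubcategory → CochainComplex A ℤ
  isTotallyAcyclic : ∀ M, IsTotallyAcyclic U (complex M)
  iso : ∀ M, (complex M).cycles 0 ≅ M.obj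

variable {U}

namespace ResolutionChoice

variable (R : ResolutionChoice U)

/-- The chosen complex, in the homotopy category. -/
def obj (M : (gorenstein U).FullSubcategory) : (totallyAcyclic U).FullSubcategory :=
  ⟨(HomotopyCategory.quotient A (ComplexShape.up ℤ)).obj (R.complex M), R.isTotallyAcyclic M⟩

/-- The morphism in the homotopy category given by a chain map between chosen complexes. -/
def homMk {M M' : (gorenstein U).FullSubcategory} (φ : R.complex M ⟶ R.complex M') :
    R.obj M ⟶ R.obj M' :=
  ObjectProperty.homMk ((HomotopyCategory.quotient A (ComplexShape.up ℤ)).map φ)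

/-- The chain map `φ` lifts `f`, i.e. it induces `f` on degree-`0` cycles. -/
def IsLift {M M' : (gorenstein U).FullSubcategory} (f : M ⟶ M')
    (φ : R.complex M ⟶ R.complex M') : Prop :=
  HomologicalComplex.cyclesMap φ 0 ≫ (R.iso M').hom = (R.iso M).hom ≫ f.hom

variable [U.IsClosedUnderFiniteProducts] [U.IsClosedUnderIsomorphisms]

/-- `T` is the functor on the stable category which sends (the class of) `M` to its chosen complex
and the class of `f` to the homotopy class of any lift of `f`. -/
structure IsResolutionFunctor
    (T : StableCategory (gorenstein U) ⥤ (totallyAcyclic U).FullSubcategory) : Prop where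
  obj_eq : ∀ M, T.obj ((stableQuotient (gorenstein U)).obj M) = R.obj M
  exists_lift : ∀ {M M' : (gorenstein U).FullSubcategory} (f : M ⟶ M'), ∃ φ, R.IsLift f φ
  map_eq : ∀ {M M' : (gorenstein U).FullSubcategory} (f : M ⟶ M')
    (φ : R.complex M ⟶ R.complex M'), R.IsLift f φ →
      T.map ((stableQuotient (gorenstein U)).map f) =
        eqToHom (obj_eq M) ≫ R.homMk φ ≫ eqToHom (obj_eq M').symm

end ResolutionChoice

end Resolutions

end RightGorenstein

namespace CategoryTheory.Equivalence

open Pretriangulated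

variable {C D : Type*} [Category* C] [Category* D] (E : C ≌ D)

section

variable (M : Type*) [AddMonoid M] [HasShift C M]

/-- The shift on `D` transported along an equivalence `C ≌ D`. -/
abbrev transportedShift : HasShift D M :=
  E.fullyFaithfulInverse.hasShift (fun m : M => E.inverse ⋙ shiftFunctor C m ⋙ E.functor)
    (fun m => Functor.isoWhiskerLeft (E.inverse ⋙ shiftFunctor C m) E.unitIso.symm)

/-- The inverse of an equivalence `C ≌ D` commutes with the shift transported to `D`. -/
abbrev transportedCommShift :
    letI := E.transportedShift M
    E.inverse.CommShift M :=
  Functor.CommShift.ofHasShiftOfFullyFaithful E.fullyFaithfulInverse _ _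

end

variable [HasShift C ℤ] [HasShift D ℤ] [Preadditive C] [Preadditive D]

lemma shiftFunctor_additive [∀ n : ℤ, (shiftFunctor C n).Additive] [E.inverse.CommShift ℤ]
    [E.inverse.Additive] (n : ℤ) : (shiftFunctor D n).Additive where
  map_add {X Y f g} := by
    apply E.inverse.map_injective
    rw [← cancel_mono ((E.inverse.commShiftIso n).hom.app Y)]
    simp [Functor.commShiftIso_hom_naturality]

variable [HasZeroObject C] [HasZeroObject D] [∀ n : ℤ, (shiftFunctor C n).Additive]
  [∀ n : ℤ, (shiftFunctor D n).Additive] [Pretriangulated C] [E.inverse.CommShift ℤ]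
  [E.inverse.Additive]

/-- The pretriangulated structure on `D` transported along an equivalence `C ≌ D`: a triangle
of `D` is distinguished if its image in `C` is. -/
abbrev transportedPretriangulated : Pretriangulated D where
  distinguishedTriangles := E.inverse.mapTriangle.obj ⁻¹' (distTriang C)
  isomorphic_distinguished T₁ hT₁ T₂ e :=
    isomorphic_distinguished _ hT₁ _ (E.inverse.mapTriangle.mapIso e)
  contractible_distinguished X :=
    isomorphic_distinguished _ (contractible_distinguished (E.inverse.obj X)) _
      (Triangle.isoMk _ _ (Iso.refl _) (Iso.refl _) E.inverse.mapZeroObject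
        ((Category.comp_id _).trans ((E.inverse.map_id X).trans (Category.id_comp _).symm))
        ((isZero_zero C).eq_of_tgt _ _)
        ((E.inverse.map_isZero (isZero_zero D)).eq_of_src _ _))
  distinguished_cocone_triangle {X Y} f := by
    obtain ⟨Z, g, h, mem⟩ := distinguished_cocone_triangle (E.inverse.map f)
    let e := E.inverse.objObjPreimageIso Z
    exact ⟨E.inverse.objPreimage Z, E.inverse.preimage (g ≫ e.inv),
      E.inverse.preimage (e.hom ≫ h ≫ (E.inverse.commShiftIso (1 : ℤ)).inv.app X),
      isomorphic_distinguished _ mem _ (Triangle.isoMk _ _ (Iso.refl _) (Iso.refl _) e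
        ((Category.comp_id _).trans (Category.id_comp _).symm)
        (by
          change E.inverse.map (E.inverse.preimage (g ≫ e.inv)) ≫ e.hom = 𝟙 _ ≫ g
          simp)
        (by
          change (E.inverse.map (E.inverse.preimage (e.hom ≫ h ≫
            (E.inverse.commShiftIso (1 : ℤ)).inv.app X)) ≫
              (E.inverse.commShiftIso (1 : ℤ)).hom.app X) ≫ (𝟙 _)⟦(1 : ℤ)⟧' = e.hom ≫ h
          simp))⟩
  rotate_distinguished_triangle T :=
    (rotate_distinguished_triangle (E.inverse.mapTriangle.obj T)).trans
      (distinguished_iff_of_iso (E.inverse.mapTriangleRotateIso.app T))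
  complete_distinguished_triangle_morphism T₁ T₂ hT₁ hT₂ a b comm := by
    obtain ⟨c, hc₁, hc₂⟩ : ∃ c : E.inverse.obj T₁.obj₃ ⟶ E.inverse.obj T₂.obj₃,
        E.inverse.map T₁.mor₂ ≫ c = E.inverse.map b ≫ E.inverse.map T₂.mor₂ ∧
        (E.inverse.map T₁.mor₃ ≫ (E.inverse.commShiftIso (1 : ℤ)).hom.app T₁.obj₁) ≫
          (E.inverse.map a)⟦(1 : ℤ)⟧' =
        c ≫ E.inverse.map T₂.mor₃ ≫ (E.inverse.commShiftIso (1 : ℤ)).hom.app T₂.obj₁ :=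
      complete_distinguished_triangle_morphism
        (E.inverse.mapTriangle.obj T₁) (E.inverse.mapTriangle.obj T₂) hT₁ hT₂ (E.inverse.map a)
        (E.inverse.map b) ((E.inverse.map_comp _ _).symm.trans
          ((E.inverse.congr_map comm).trans (E.inverse.map_comp _ _)))
    obtain ⟨c, rfl⟩ := E.inverse.map_surjective c
    refine ⟨c, E.inverse.map_injective (by simpa using hc₁), E.inverse.map_injective ?_⟩
    have := E.inverse.commShiftIso_hom_naturality a (1 : ℤ)
    rw [← cancel_mono ((E.inverse.commShiftIso (1 : ℤ)).hom.app T₂.obj₁)]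
    simpa [this] using hc₂

lemma inverse_isTriangulated :
    letI := E.transportedPretriangulated
    E.inverse.IsTriangulated :=
  letI := E.transportedPretriangulated
  { map_distinguished := fun _ hT => hT }

lemma transported_isTriangulated [CategoryTheory.IsTriangulated C] :
    letI := E.transportedPretriangulated
    CategoryTheory.IsTriangulated D := by
  let := E.transportedPretriangulated
  have := E.inverse_isTriangulated
  exact CategoryTheory.IsTriangulated.of_fully_faithful_triangulated_functor E.inverse

end CategoryTheory.Equivalence

namespace RightGorenstein

variable {A : Type u} [Category.{v} A] [Abelian A]

section

variable (P : ObjectProperty A)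

instance : (stableQuotient P).Full :=
  inferInstanceAs (CategoryTheory.Quotient.functor (stableRel P)).Full

instance : (stableQuotient P).EssSurj :=
  inferInstanceAs (CategoryTheory.Quotient.functor (stableRel P)).EssSurj

variable {P} [P.IsClosedUnderFiniteProducts]

lemma stableQuotient_map_eq_iff {X Y : P.FullSubcategory} (f g : X ⟶ Y) :
    (stableQuotient P).map f = (stableQuotient P).map g ↔ stableRel P f g :=
  CategoryTheory.Quotient.functor_map_eq_iff _ _ _

end

section Lifting

/-- A relation between consecutive terms which is total on both sides can be solved over `ℤ`,
with a prescribed value at `0`. -/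
lemma exists_int_sequence {F : ℤ → Type*} (R : ∀ n, F n → F (n + 1) → Prop)
    (hr : ∀ n x, ∃ y, R n x y) (hl : ∀ n y, ∃ x, R n x y) (x₀ : F 0) :
    ∃ x : ∀ n, F n, x 0 = x₀ ∧ ∀ n, R n (x n) (x (n + 1)) := by
  choose up hup using hr
  choose down hdown using hl
  let pos : ∀ k : ℕ, F (Int.ofNat k) := fun k =>
    Nat.rec (motive := fun k => F (Int.ofNat k)) x₀ (fun k y => up (Int.ofNat k) y) k
  let neg : ∀ k : ℕ, F (Int.negSucc k) := fun k =>
    Nat.rec (motive := fun k => F (Int.negSucc k)) (down (Int.negSucc 0) x₀)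
      (fun k y => down (Int.negSucc (k + 1)) y) k
  refine ⟨fun n => match n with
    | Int.ofNat k => pos k
    | Int.negSucc k => neg k, rfl, ?_⟩
  rintro (k | k)
  · exact hup (Int.ofNat k) (pos k)
  · cases k with
    | zero => exact hdown (Int.negSucc 0) x₀
    | succ k => exact hdown (Int.negSucc (k + 1)) (neg k)

variable {U : ObjectProperty A}

namespace IsTotallyAcyclic

variable {T T' : CochainComplex A ℤ}

lemma epi_toCycles (hT : IsTotallyAcyclic U T) (n m : ℤ) (h : n + 1 = m) :
    Epi (T.toCycles n m) :=
  (cyclesSequence_shortExact hT.acyclic n m h).epi_g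

/-- Morphisms from cycles to objects of `U ∩ U^⊥` extend to the terms of the complex. -/
lemma exists_extension (hT : IsTotallyAcyclic U T) (n : ℤ) {W : A} (hW : U W)
    (hW' : rightOrthogonal U W) (f : T.cycles n ⟶ W) :
    ∃ g : T.X n ⟶ W, T.iCycles n ≫ g = f := by
  obtain ⟨g, hg⟩ := hT.exists_from (n - 1 - 1) (n - 1) n (by simp) (by simp) hW hW'
    (T.toCycles (n - 1) n ≫ f) (by simp)
  have := hT.epi_toCycles (n - 1) n (by simp)
  exact ⟨g, by rw [← cancel_epi (T.toCycles (n - 1) n), ← hg, T.toCycles_i_assoc]⟩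

lemma exists_lift_toCycles (hT : IsTotallyAcyclic U T) (n m : ℤ) (h : n + 1 = m) {X : A}
    (hX : U X) (f : X ⟶ T.cycles m) : ∃ g : X ⟶ T.X n, g ≫ T.toCycles n m = f :=
  exists_lift (cyclesSequence_shortExact hT.acyclic n m h) (hT.cycles_mem n) hX f

lemma exists_desc_toCycles (hT : IsTotallyAcyclic U T) (n m : ℤ) (h : n + 1 = m) {X : A}
    (f : T.X n ⟶ X) (hf : T.iCycles n ≫ f = 0) : ∃ g : T.cycles m ⟶ X, T.toCycles n m ≫ g = f :=
  have hS := cyclesSequence_shortExact hT.acyclic n m h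
  ⟨hS.gIsCokernel.desc (CokernelCofork.ofπ f hf),
    hS.gIsCokernel.fac (CokernelCofork.ofπ f hf) WalkingParallelPair.one⟩

/-- Every morphism between degree-`0` cycles is induced by a chain map. -/
lemma exists_cyclesMap_eq (hT : IsTotallyAcyclic U T) (hT' : IsTotallyAcyclic U T')
    (f : T.cycles 0 ⟶ T'.cycles 0) :
    ∃ φ : T ⟶ T', HomologicalComplex.cyclesMap φ 0 = f := by
  let R (n : ℤ) (a : T.cycles n ⟶ T'.cycles n) (b : T.cycles (n + 1) ⟶ T'.cycles (n + 1)) :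
      Prop := ∃ g : T.X n ⟶ T'.X n, T.iCycles n ≫ g = a ≫ T'.iCycles n ∧
        T.toCycles n (n + 1) ≫ b = g ≫ T'.toCycles n (n + 1)
  have hr (n a) : ∃ b, R n a b := by
    obtain ⟨g, hg⟩ := hT.exists_extension n (hT'.mem n) (hT'.rightOrthogonal_X n)
      (a ≫ T'.iCycles n)
    obtain ⟨b, hb⟩ := hT.exists_desc_toCycles n (n + 1) rfl (g ≫ T'.toCycles n (n + 1)) (by
      rw [reassoc_of% hg, (cyclesSequence T' n (n + 1)).zero, comp_zero])
    exact ⟨b, g, hg, hb⟩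
  have hl (n b) : ∃ a, R n a b := by
    obtain ⟨g, hg⟩ := hT'.exists_lift_toCycles n (n + 1) rfl (hT.mem n)
      (T.toCycles n (n + 1) ≫ b)
    have : T.iCycles n ≫ T.toCycles n (n + 1) = 0 := (cyclesSequence T n (n + 1)).zero
    refine ⟨T'.liftCycles (T.iCycles n ≫ g) (n + 1) (by simp) ?_, g,
      (T'.liftCycles_i _ _ _ _).symm, hg.symm⟩
    rw [← T'.toCycles_i, Category.assoc, reassoc_of% hg, reassoc_of% this, zero_comp]
  obtain ⟨x, hx₀, hx⟩ := exists_int_sequence R hr hl f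
  choose g hg hg' using hx
  refine ⟨{ f := g, comm' := ?_ }, ?_⟩
  · rintro n _ rfl
    rw [← T'.toCycles_i, ← reassoc_of% (hg' n), ← hg, T.toCycles_i_assoc]
  · rw [← cancel_mono (T'.iCycles 0), HomologicalComplex.cyclesMap_i, ← hx₀]
    exact hg 0

/-- A chain map is null-homotopic if the morphism it induces on degree-`0` cycles lifts to
the term of degree `-1`. -/
lemma homotopic_zero (hT : IsTotallyAcyclic U T) (hT' : IsTotallyAcyclic U T')
    (φ : T ⟶ T') (s : T.cycles 0 ⟶ T'.X (-1))
    (hs : s ≫ T'.toCycles (-1) 0 = HomologicalComplex.cyclesMap φ 0) :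
    Nonempty (Homotopy φ 0) := by
  let F (n : ℤ) := { s : T.cycles n ⟶ T'.X (n - 1) //
    s ≫ T'.d (n - 1) n = T.iCycles n ≫ φ.f n }
  have hs' : s ≫ T'.d (-1) 0 = T.iCycles 0 ≫ φ.f 0 := by
    rw [← HomologicalComplex.cyclesMap_i, ← hs, Category.assoc, T'.toCycles_i]
  let R (n : ℤ) (a : F n) (b : F (n + 1)) : Prop := ∃ h : T.X n ⟶ T'.X (n - 1),
    T.iCycles n ≫ h = a.1 ∧ h ≫ T'.d (n - 1) n +
      T.toCycles n (n + 1) ≫ b.1 ≫ (T'.XIsoOfEq (by simp)).hom = φ.f n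
  have hr (n a) : ∃ b, R n a b := by
    obtain ⟨a, ha⟩ := a
    obtain ⟨h, hh⟩ := hT.exists_extension n (hT'.mem _) (hT'.rightOrthogonal_X _) a
    obtain ⟨b, hb⟩ := hT.exists_desc_toCycles n (n + 1) rfl (φ.f n - h ≫ T'.d (n - 1) n) (by
      rw [Preadditive.comp_sub, reassoc_of% hh, ha, sub_self])
    have := hT.epi_toCycles n (n + 1) rfl
    refine ⟨⟨b ≫ (T'.XIsoOfEq (by simp)).hom, ?_⟩, h, hh, by simp [hb]⟩
    rw [← cancel_epi (T.toCycles n (n + 1)), Category.assoc, reassoc_of% hb]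
    simp
  have hl (n b) : ∃ a, R n a b := by
    obtain ⟨b, hb⟩ := b
    obtain ⟨h, hh⟩ := hT'.exists_to (n - 1) n (n + 1) (by simp) rfl (hT.mem n)
      (φ.f n - T.toCycles n (n + 1) ≫ b ≫ (T'.XIsoOfEq (by simp)).hom) (by
        simp only [Preadditive.sub_comp, Category.assoc, HomologicalComplex.XIsoOfEq_hom_comp_d, hb]
        simp)
    have h0 : T.iCycles n ≫ T.toCycles n (n + 1) = 0 := (cyclesSequence T n (n + 1)).zero
    refine ⟨⟨T.iCycles n ≫ h, ?_⟩, h, rfl, ?_⟩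
    · rw [Category.assoc, hh, Preadditive.comp_sub, reassoc_of% h0, zero_comp, sub_zero]
    · rw [hh, sub_add_cancel]
  obtain ⟨x, -, hx⟩ := exists_int_sequence R hr hl ⟨s, hs'⟩
  choose h hh hh' using hx
  refine ⟨{
    hom := fun i j => if hij : j + 1 = i then h i ≫ (T'.XIsoOfEq (by lia)).hom else 0
    zero := fun i j hij => dif_neg hij
    comm := fun n => ?_ }⟩
  rw [dNext_eq _ (show (ComplexShape.up ℤ).Rel n (n + 1) by simp),
    prevD_eq _ (show (ComplexShape.up ℤ).Rel (n - 1) n by simp), dif_pos rfl, dif_pos (by simp),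
    ← hh', ← hh]
  simp only [HomologicalComplex.toCycles_i_assoc, Category.assoc, HomologicalComplex.zero_f,
    HomologicalComplex.XIsoOfEq_rfl, Iso.refl_hom, Category.comp_id, add_zero]
  exact add_comm _ _

end IsTotallyAcyclic

/-- The degree-`n` cycles of a complex are the degree-`0` cycles of its shift. -/
noncomputable def cyclesShiftIso (T : CochainComplex A ℤ) (n : ℤ) :
    (T⟦n⟧).cycles 0 ≅ T.cycles n :=
  ShortComplex.cyclesMapIso ((CochainComplex.shiftShortComplexFunctorIso A n 0 n (by simp)).app T)

lemma IsTotallyAcyclic.gorenstein_cycles {T : CochainComplex A ℤ} (hT : IsTotallyAcyclic U T)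
    (n : ℤ) : gorenstein U (T.cycles n) :=
  ⟨T⟦n⟧, hT.shift n, ⟨cyclesShiftIso T n⟩⟩

section

variable [U.IsClosedUnderFiniteProducts] [U.IsClosedUnderIsomorphisms]

/-- The conflation `0 ⟶ Zⁿ ⟶ Tⁿ ⟶ Zᵐ ⟶ 0` of right Gorenstein objects, for `m = n + 1`. -/
noncomputable abbrev IsTotallyAcyclic.conflation {T : CochainComplex A ℤ}
    (hT : IsTotallyAcyclic U T) (n m : ℤ) : ShortComplex (gorenstein U).FullSubcategory :=
  ShortComplex.mk (X₁ := ⟨_, hT.gorenstein_cycles n⟩) (X₂ := ⟨_, gorenstein_X hT n⟩)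
    (X₃ := ⟨_, hT.gorenstein_cycles m⟩)
    (ObjectProperty.homMk (T.iCycles n)) (ObjectProperty.homMk (T.toCycles n m))
    (by ext; exact (cyclesSequence T n m).zero)

lemma IsTotallyAcyclic.isConflation {T : CochainComplex A ℤ} (hT : IsTotallyAcyclic U T)
    (n m : ℤ) (h : n + 1 = m) : IsConflation (gorenstein U) (hT.conflation n m) :=
  cyclesSequence_shortExact hT.acyclic n m h

lemma isRelProjective_X {T : CochainComplex A ℤ} (hT : IsTotallyAcyclic U T) (n : ℤ) :
    IsRelProjective (gorenstein U) ⟨T.X n, gorenstein_X hT n⟩ :=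
  isRelProjective_of_mem _ _ (hT.mem _)

lemma isRelInjective_X {T : CochainComplex A ℤ} (hT : IsTotallyAcyclic U T) (n : ℤ) :
    IsRelInjective (gorenstein U) ⟨T.X n, gorenstein_X hT n⟩ :=
  isRelInjective_of_mem _ _ (hT.mem _) (hT.rightOrthogonal_X _)

instance : (cyclesZero U).Full where
  map_surjective {T T'} f := by
    obtain ⟨f, rfl⟩ := (stableQuotient (gorenstein U)).map_surjective f
    obtain ⟨φ, hφ⟩ := T.property.exists_cyclesMap_eq T'.property f.hom
    refine ⟨ObjectProperty.homMk ((HomotopyCategory.quotient A _).map φ), ?_⟩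
    rw [cyclesZero_map]
    exact congrArg _ (by ext; exact hφ)

lemma homotopic_zero_of_stableRel {T T' : CochainComplex A ℤ} (hT : IsTotallyAcyclic U T)
    (hT' : IsTotallyAcyclic U T') (φ : T ⟶ T')
    (h : stableRel (gorenstein U) (X := ⟨_, hT.gorenstein_cycles 0⟩)
      (Y := ⟨_, hT'.gorenstein_cycles 0⟩)
      (ObjectProperty.homMk (HomologicalComplex.cyclesMap φ 0)) 0) :
    (HomotopyCategory.quotient A (ComplexShape.up ℤ)).map φ = 0 := by
  obtain ⟨I, a, b, hI, -, hab⟩ := h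
  obtain ⟨c, hc⟩ := hI _ (hT'.isConflation (-1) 0 (by simp)) b
  obtain ⟨H⟩ := hT.homotopic_zero hT' φ (a ≫ c).hom (by
    rw [sub_zero, ← hc] at hab
    exact (Category.assoc _ _ _).trans (congrArg (·.hom) hab))
  rw [HomotopyCategory.eq_of_homotopy _ _ H, Functor.map_zero]

lemma quotient_map_eq_of_stableQuotient_map_eq {T T' : CochainComplex A ℤ}
    (hT : IsTotallyAcyclic U T) (hT' : IsTotallyAcyclic U T') (φ ψ : T ⟶ T')
    (h : (stableQuotient (gorenstein U)).map
        (ObjectProperty.homMk (HomologicalComplex.cyclesMap φ 0) :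
          (⟨_, hT.gorenstein_cycles 0⟩ : (gorenstein U).FullSubcategory) ⟶
            ⟨_, hT'.gorenstein_cycles 0⟩) =
      (stableQuotient (gorenstein U)).map
        (ObjectProperty.homMk (HomologicalComplex.cyclesMap ψ 0))) :
    (HomotopyCategory.quotient A (ComplexShape.up ℤ)).map φ =
      (HomotopyCategory.quotient A (ComplexShape.up ℤ)).map ψ := by
  rw [← sub_eq_zero, ← Functor.map_sub]
  apply homotopic_zero_of_stableRel hT hT'
  obtain ⟨I, a, b, hI, hI', hab⟩ := (stableQuotient_map_eq_iff _ _).1 h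
  refine ⟨I, a, b, hI, hI', hab.trans ?_⟩
  ext
  change HomologicalComplex.cyclesMap φ 0 - HomologicalComplex.cyclesMap ψ 0 =
    HomologicalComplex.cyclesMap (φ - ψ) 0 - 0
  rw [← cancel_mono (T'.iCycles 0)]
  simp

instance : (cyclesZero U).Faithful where
  map_injective {T T' f g} h := by
    ext
    rw [← HomotopyCategory.quotient_map_out f.hom, ← HomotopyCategory.quotient_map_out g.hom]
    exact quotient_map_eq_of_stableQuotient_map_eq T.property T'.property _ _ h

instance : (cyclesZero U).EssSurj where
  mem_essImage := by
    rintro ⟨M, T, hT, ⟨e⟩⟩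
    exact ⟨⟨(HomotopyCategory.quotient _ _).obj T, hT⟩, ⟨(stableQuotient (gorenstein U)).mapIso
      ((gorenstein U).isoMk e)⟩⟩

instance : (cyclesZero U).IsEquivalence where

instance : (cyclesZero U).Additive where
  map_add {T T' f g} := by
    obtain ⟨φ, hφ⟩ := (HomotopyCategory.quotient A _).map_surjective f.hom
    obtain ⟨ψ, hψ⟩ := (HomotopyCategory.quotient A _).map_surjective g.hom
    obtain rfl : f = ObjectProperty.homMk ((HomotopyCategory.quotient A _).map φ) := by
      ext; exact hφ.symm
    obtain rfl : g = ObjectProperty.homMk ((HomotopyCategory.quotient A _).map ψ) := by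
      ext; exact hψ.symm
    have h₁ : (ObjectProperty.homMk ((HomotopyCategory.quotient A _).map φ) : T ⟶ T') +
        ObjectProperty.homMk ((HomotopyCategory.quotient A _).map ψ) =
        ObjectProperty.homMk ((HomotopyCategory.quotient A _).map (φ + ψ)) := by
      ext; exact ((HomotopyCategory.quotient A _).map_add (f := φ) (g := ψ)).symm
    have h₂ : HomologicalComplex.cyclesMap (φ + ψ) 0 =
        HomologicalComplex.cyclesMap φ 0 + HomologicalComplex.cyclesMap ψ 0 := by
      rw [← cancel_mono (HomologicalComplex.iCycles _ 0)]
      simp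
    rw [h₁, cyclesZero_map, cyclesZero_map, cyclesZero_map, h₂]
    exact (stableQuotient (gorenstein U)).map_add

end

end Lifting

section Triangulation

variable (U : ObjectProperty A) [U.IsClosedUnderFiniteProducts] [U.IsClosedUnderIsomorphisms]

/-- The equivalence between the homotopy category of totally acyclic complexes and the
stable category. -/
noncomputable def cyclesZeroEquivalence :
    (totallyAcyclic U).FullSubcategory ≌ StableCategory (gorenstein U) :=
  (cyclesZero U).asEquivalence

instance : (cyclesZeroEquivalence U).functor.Additive :=
  inferInstanceAs (cyclesZero U).Additive

noncomputable instance : HasShift (StableCategory (gorenstein U)) ℤ :=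
  (cyclesZeroEquivalence U).transportedShift ℤ

noncomputable instance : (cyclesZeroEquivalence U).inverse.CommShift ℤ :=
  (cyclesZeroEquivalence U).transportedCommShift ℤ

noncomputable instance : (cyclesZero U).CommShift ℤ :=
  (cyclesZeroEquivalence U).commShiftFunctor ℤ

instance (n : ℤ) : (shiftFunctor (StableCategory (gorenstein U)) n).Additive :=
  (cyclesZeroEquivalence U).shiftFunctor_additive n

noncomputable instance : Pretriangulated (StableCategory (gorenstein U)) :=
  (cyclesZeroEquivalence U).transportedPretriangulated

instance : IsTriangulated (StableCategory (gorenstein U)) :=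
  (cyclesZeroEquivalence U).transported_isTriangulated

instance : (cyclesZero U).IsTriangulated := by
  let : (cyclesZeroEquivalence U).functor.CommShift ℤ :=
    (cyclesZeroEquivalence U).commShiftFunctor ℤ
  have := (cyclesZeroEquivalence U).commShift_of_inverse ℤ
  exact (Equivalence.IsTriangulated.mk'' (cyclesZeroEquivalence U)
    (cyclesZeroEquivalence U).inverse_isTriangulated).leftAdjoint_isTriangulated

end Triangulation

section DegreewiseSplit

open HomologicalComplex CochainComplex

/-- The inclusion in `T¹` of the degree-`0` cycles of `T⟦1⟧`. -/
noncomputable def iCyclesShift (T : CochainComplex A ℤ) : (T⟦(1 : ℤ)⟧).cycles 0 ⟶ T.X 1 :=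
  (T⟦(1 : ℤ)⟧).iCycles 0

instance (T : CochainComplex A ℤ) : Mono (iCyclesShift T) :=
  inferInstanceAs (Mono ((T⟦(1 : ℤ)⟧).iCycles 0))

lemma cyclesMap_iCyclesShift {T T' : CochainComplex A ℤ} (φ : T ⟶ T'⟦(1 : ℤ)⟧)
    (f : T.X 0 ⟶ T'.X 1) (hf : φ.f 0 = f) :
    cyclesMap φ 0 ≫ iCyclesShift T' = T.iCycles 0 ≫ f := by
  subst hf
  exact cyclesMap_i φ 0

lemma cyclesMap_shift_iCyclesShift {T T' : CochainComplex A ℤ} (φ : T ⟶ T') :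
    cyclesMap (φ⟦(1 : ℤ)⟧') 0 ≫ iCyclesShift T' = iCyclesShift T ≫ φ.f 1 :=
  cyclesMap_i (φ⟦(1 : ℤ)⟧') 0

lemma shift_one_d (T : CochainComplex A ℤ) : (T⟦(1 : ℤ)⟧).d 0 1 = - T.d 1 2 := by
  rw [shiftFunctor_obj_d', Int.negOnePow_one, Units.neg_smul, one_smul]
  rfl

lemma exists_lift_iCyclesShift (T : CochainComplex A ℤ) {X : A} (f : X ⟶ T.X 1)
    (hf : f ≫ T.d 1 2 = 0) : ∃ g, g ≫ iCyclesShift T = f :=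
  ⟨(T⟦(1 : ℤ)⟧).liftCycles (A := X) (i := 0) f 1 (by simp) (by
    rw [shift_one_d]
    exact (Preadditive.comp_neg _ _).trans (neg_eq_zero.2 hf)),
    (T⟦(1 : ℤ)⟧).liftCycles_i _ _ _ _⟩

/-- The sequence of degree-`0` cycles of a short complex of complexes. -/
noncomputable abbrev cyclesShortComplex (S : ShortComplex (CochainComplex A ℤ)) :
    ShortComplex A :=
  ShortComplex.mk (cyclesMap S.f 0) (cyclesMap S.g 0) (by rw [← cyclesMap_comp, S.zero]; simp)

section

variable (S : ShortComplex (CochainComplex A ℤ))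
  (r : ∀ n, S.X₂.X n ⟶ S.X₁.X n) (s : ∀ n, S.X₃.X n ⟶ S.X₂.X n)

lemma cyclesShortComplex_shortExact (f_r : ∀ n, S.f.f n ≫ r n = 𝟙 _)
    (s_g : ∀ n, s n ≫ S.g.f n = 𝟙 _) (h : ∀ n, r n ≫ S.f.f n + S.g.f n ≫ s n = 𝟙 _)
    (hS : S.X₁.Acyclic) : (cyclesShortComplex S).ShortExact := by
  have (n : ℤ) : IsSplitMono (S.f.f n) := ⟨⟨⟨r n, f_r n⟩⟩⟩
  have h' {X : A} (n : ℤ) (x : X ⟶ S.X₂.X n) (hx : x ≫ S.g.f n = 0) :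
      (x ≫ r n) ≫ S.f.f n = x := by
    have := x ≫= h n
    rwa [Preadditive.comp_add, reassoc_of% hx, zero_comp, add_zero, Category.comp_id,
      ← Category.assoc] at this
  exact {
    mono_f := by
      have h : cyclesMap S.f 0 ≫ S.X₂.iCycles 0 = S.X₁.iCycles 0 ≫ S.f.f 0 := cyclesMap_i _ _
      exact mono_of_mono_fac h
    exact := by
      rw [ShortComplex.exact_iff_exact_up_to_refinements]
      intro X (x : X ⟶ S.X₂.cycles 0) (hx : x ≫ cyclesMap S.g 0 = 0)
      have hx' := h' 0 (x ≫ S.X₂.iCycles 0) (by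
        rw [Category.assoc, ← cyclesMap_i, reassoc_of% hx, zero_comp])
      refine ⟨X, 𝟙 X, inferInstance,
        S.X₁.liftCycles ((x ≫ S.X₂.iCycles 0) ≫ r 0) 1 (by simp) ?_, ?_⟩
      · rw [← cancel_mono (S.f.f 1), Category.assoc, ← S.f.comm, ← Category.assoc, hx']
        simp
      · rw [← cancel_mono (S.X₂.iCycles 0)]
        dsimp only
        rw [Category.assoc, Category.assoc, cyclesMap_i, liftCycles_i_assoc, hx',
          Category.id_comp]
    epi_g := by
      dsimp
      rw [epi_iff_surjective_up_to_refinements]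
      intro X (y : X ⟶ S.X₃.cycles 0)
      obtain ⟨t, ht⟩ : ∃ t, t ≫ S.g.f 0 = y ≫ S.X₃.iCycles 0 :=
        ⟨y ≫ S.X₃.iCycles 0 ≫ s 0, by simp [s_g]⟩
      have hc := h' 1 (t ≫ S.X₂.d 0 1) (by
        rw [Category.assoc, ← S.g.comm, reassoc_of% ht]
        simp)
      have : Epi (S.X₁.toCycles 0 1) := (cyclesSequence_shortExact hS 0 1 rfl).epi_g
      obtain ⟨X', π, hπ, a, ha⟩ := surjective_up_to_refinements_of_epi (S.X₁.toCycles 0 1)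
        (S.X₁.liftCycles ((t ≫ S.X₂.d 0 1) ≫ r 1) 2 (by simp) (by
          rw [← cancel_mono (S.f.f 2), Category.assoc, ← S.f.comm, ← Category.assoc, hc]
          simp))
      have ha' : π ≫ t ≫ S.X₂.d 0 1 = a ≫ S.f.f 0 ≫ S.X₂.d 0 1 := by
        have := ha =≫ S.X₁.iCycles 1 ≫ S.f.f 1
        rw [Category.assoc, liftCycles_i_assoc, hc, Category.assoc, toCycles_i_assoc] at this
        rw [this, S.f.comm]
      refine ⟨X', π, hπ, S.X₂.liftCycles (π ≫ t - a ≫ S.f.f 0) 1 (by simp) ?_, ?_⟩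
      · rw [Preadditive.sub_comp, Category.assoc, Category.assoc, ha', sub_self]
      · have : S.f.f 0 ≫ S.g.f 0 = 0 := by rw [← comp_f, S.zero, zero_f]
        rw [← cancel_mono (S.X₃.iCycles 0), Category.assoc, Category.assoc, cyclesMap_i,
          liftCycles_i_assoc, Preadditive.sub_comp, Category.assoc, Category.assoc, ht, this,
          comp_zero, sub_zero] }

/-- Compatibility of the connecting morphism of a degreewise split exact sequence of complexes
with the sequence of cycles. -/
lemma iCycles_comp_retraction_d (f_r : ∀ n, S.f.f n ≫ r n = 𝟙 _)
    (h : ∀ n, r n ≫ S.f.f n + S.g.f n ≫ s n = 𝟙 _) (γ : S.X₃ ⟶ S.X₁⟦(1 : ℤ)⟧)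
    (hγ : γ.f 0 = (s 0 ≫ S.X₂.d 0 1 ≫ r 1 :)) :
    (S.X₂.iCycles 0 ≫ r 0) ≫ S.X₁.d 0 1 =
      - (cyclesMap S.g 0 ≫ cyclesMap γ 0 ≫ iCyclesShift S.X₁) := by
  have h₁ : (r 0 ≫ S.X₁.d 0 1) + S.g.f 0 ≫ s 0 ≫ S.X₂.d 0 1 ≫ r 1 = S.X₂.d 0 1 ≫ r 1 := by
    have := h 0 =≫ (S.X₂.d 0 1 ≫ r 1)
    rw [Preadditive.add_comp, Category.assoc, Category.assoc, Category.id_comp,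
      S.f.comm_assoc, f_r, Category.comp_id] at this
    exact this
  rw [cyclesMap_iCyclesShift γ _ hγ, cyclesMap_i_assoc, Category.assoc,
    ← add_eq_zero_iff_eq_neg, ← Preadditive.comp_add, h₁, iCycles_d_assoc, zero_comp]

end

section

variable {T₁ T₃ : CochainComplex A ℤ} (γ : T₃ ⟶ T₁⟦(1 : ℤ)⟧)

/-- The components of a morphism `T₃ ⟶ T₁⟦1⟧`. -/
def shiftHomApp (n : ℤ) : T₃.X n ⟶ T₁.X (n + 1) := γ.f n

/-- The differential of the extension of `T₃` by `T₁` given by a morphism `T₃ ⟶ T₁⟦1⟧`. -/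
noncomputable def extensionD (n : ℤ) : T₁.X n ⊞ T₃.X n ⟶ T₁.X (n + 1) ⊞ T₃.X (n + 1) :=
  biprod.fst ≫ T₁.d n (n + 1) ≫ biprod.inl +
    biprod.snd ≫ (shiftHomApp γ n ≫ biprod.inl +
      T₃.d n (n + 1) ≫ biprod.inr)

lemma extension_comm (n : ℤ) :
    shiftHomApp γ n ≫ T₁.d (n + 1) (n + 1 + 1) +
      T₃.d n (n + 1) ≫ shiftHomApp γ (n + 1) = 0 := by
  have h := γ.comm n (n + 1)
  rw [shiftFunctor_obj_d', Int.negOnePow_one, Units.neg_smul, one_smul] at h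
  rw [← neg_eq_iff_add_eq_zero]
  exact (Preadditive.comp_neg _ _).symm.trans h

/-- The extension of `T₃` by `T₁` given by a morphism `T₃ ⟶ T₁⟦1⟧`. -/
noncomputable def extension : CochainComplex A ℤ :=
  CochainComplex.of (fun n => T₁.X n ⊞ T₃.X n) (extensionD γ) (fun n => by
    apply biprod.hom_ext'
    · simp [extensionD]
    · apply biprod.hom_ext
      · simpa [extensionD] using extension_comm γ n
      · simp [extensionD])

lemma extension_d (n : ℤ) : (extension γ).d n (n + 1) = extensionD γ n := by
  simp [extension, CochainComplex.of]

lemma inl_extensionD (n : ℤ) :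
    biprod.inl ≫ extensionD γ n = T₁.d n (n + 1) ≫ biprod.inl := by
  simp [extensionD]

lemma extensionD_snd (n : ℤ) :
    extensionD γ n ≫ biprod.snd = biprod.snd ≫ T₃.d n (n + 1) := by
  simp [extensionD]

lemma inr_extensionD_fst (n : ℤ) :
    biprod.inr ≫ extensionD γ n ≫ biprod.fst = shiftHomApp γ n := by
  simp [extensionD]

/-- The degreewise split short exact sequence given by a morphism `T₃ ⟶ T₁⟦1⟧`. -/
noncomputable abbrev extensionSequence : ShortComplex (CochainComplex A ℤ) where
  X₁ := T₁
  X₂ := extension γ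
  X₃ := T₃
  f :=
    { f := fun n => (biprod.inl : _ ⟶ T₁.X n ⊞ T₃.X n)
      comm' := by
        rintro n _ rfl
        rw [extension_d]
        exact inl_extensionD γ n }
  g :=
    { f := fun n => (biprod.snd : T₁.X n ⊞ T₃.X n ⟶ _)
      comm' := by
        rintro n _ rfl
        rw [extension_d]
        exact (extensionD_snd γ n).symm }
  zero := by
    ext n
    exact biprod.inl_snd

/-- The inclusion of the degree-`0` cycles of `extension γ`. -/
noncomputable def iCyclesExtension : (extension γ).cycles 0 ⟶ T₁.X 0 ⊞ T₃.X 0 :=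
  (extension γ).iCycles 0

instance : Mono (iCyclesExtension γ) := inferInstanceAs (Mono ((extension γ).iCycles 0))

lemma cyclesMap_iCyclesExtension :
    cyclesMap (extensionSequence γ).f 0 ≫ iCyclesExtension γ = T₁.iCycles 0 ≫ biprod.inl :=
  cyclesMap_i (extensionSequence γ).f 0

lemma iCyclesExtension_snd :
    iCyclesExtension γ ≫ biprod.snd = cyclesMap (extensionSequence γ).g 0 ≫ T₃.iCycles 0 :=
  (cyclesMap_i (extensionSequence γ).g 0).symm

/-- The degreewise splitting of `extensionSequence`. -/
noncomputable def extensionSplitting (n : ℤ) :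
    ((extensionSequence γ).map (eval A _ n)).Splitting :=
  ShortComplex.Splitting.ofHasBinaryBiproduct (T₁.X n) (T₃.X n)

lemma inr_extension_d_fst (n : ℤ) :
    (biprod.inr : _ ⟶ T₁.X n ⊞ T₃.X n) ≫ (extension γ).d n (n + 1) ≫
      (biprod.fst : T₁.X (n + 1) ⊞ T₃.X (n + 1) ⟶ _) = shiftHomApp γ n := by
  rw [extension_d]
  exact inr_extensionD_fst γ n

lemma homOfDegreewiseSplit_extensionSplitting :
    homOfDegreewiseSplit (extensionSequence γ) (extensionSplitting γ) = γ := by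
  ext n
  rw [homOfDegreewiseSplit_f]
  exact inr_extension_d_fst γ n

lemma cyclesShortComplex_extensionSequence_shortExact (hT₁ : T₁.Acyclic) :
    (cyclesShortComplex (extensionSequence γ)).ShortExact :=
  cyclesShortComplex_shortExact _ (fun n => (extensionSplitting γ n).r)
    (fun n => (extensionSplitting γ n).s) (fun n => (extensionSplitting γ n).f_r)
    (fun n => (extensionSplitting γ n).s_g) (fun n => (extensionSplitting γ n).id) hT₁

lemma iCyclesExtension_fst_d :
    (iCyclesExtension γ ≫ biprod.fst) ≫ T₁.d 0 1 =
      - (cyclesMap (extensionSequence γ).g 0 ≫ cyclesMap γ 0 ≫ iCyclesShift T₁) :=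
  iCycles_comp_retraction_d (extensionSequence γ) (fun n => (extensionSplitting γ n).r)
    (fun n => (extensionSplitting γ n).s) (fun n => (extensionSplitting γ n).f_r)
    (fun n => (extensionSplitting γ n).id) γ (inr_extension_d_fst γ 0).symm

variable {U : ObjectProperty A}

lemma IsTotallyAcyclic.of_iso [U.IsClosedUnderIsomorphisms] {T T' : CochainComplex A ℤ}
    (hT : IsTotallyAcyclic U T) (e : T ≅ T') : IsTotallyAcyclic U T' where
  acyclic n := (hT.acyclic n).of_iso e
  mem n := U.prop_of_iso ((eval A _ n).mapIso e) (hT.mem n)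
  cycles_mem n := (rightOrthogonal U).prop_of_iso ((cyclesFunctor A _ n).mapIso e)
    (hT.cycles_mem n)
  hom_acyclic W hW hW' := (hom_acyclic_iff T' W).2 fun n m k hn hm f hf => by
    obtain ⟨g, hg⟩ := hT.exists_from n m k hn hm hW hW' (e.hom.f m ≫ f) (by
      rw [← e.hom.comm_assoc, hf, comp_zero])
    refine ⟨e.inv.f k ≫ g, ?_⟩
    rw [← e.inv.comm_assoc, hg, ← comp_f_assoc, e.inv_hom_id, id_f, Category.id_comp]

lemma IsTotallyAcyclic.extension [U.IsClosedUnderFiniteProducts] [U.IsClosedUnderIsomorphisms]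
    (hT₁ : IsTotallyAcyclic U T₁) (hT₃ : IsTotallyAcyclic U T₃) :
    IsTotallyAcyclic U (extension γ) := by
  have h := (hT₃.cone (hT₁.shift 1) γ)
  let e := mappingConeHomOfDegreewiseSplitIso (extensionSequence γ) (extensionSplitting γ)
  rw [homOfDegreewiseSplit_extensionSplitting] at e
  exact ((h.of_iso e).shift (-1)).of_iso ((shiftShiftNeg (extensionSequence γ).X₂ (1 : ℤ)))

end

end DegreewiseSplit

section Connecting

open HomologicalComplex CochainComplex

variable {U : ObjectProperty A}

/-- `Ext¹(M, W) = 0` for `M` right Gorenstein and `W` in `U ∩ U^⊥`: morphisms to `W` extend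
along inflations with cokernel `M`. -/
lemma exists_desc_of_gorenstein {S : ShortComplex A} (hS : S.ShortExact)
    (h₃ : gorenstein U S.X₃) {W : A} (hW : U W) (hW' : rightOrthogonal U W) (f : S.X₁ ⟶ W) :
    ∃ g : S.X₂ ⟶ W, S.f ≫ g = f := by
  obtain ⟨T, hT, ⟨e⟩⟩ := h₃
  have h := ext_eq_zero_of_desc (cyclesSequence_shortExact hT.acyclic (-1) 0 (by simp))
    (hW' (hT.mem (-1))) (fun f => hT.exists_extension _ hW hW' f)
  refine exists_desc hS (W := W) ?_ f
  have : HasExt.{max u v} A := HasExt.standard A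
  intro x
  have hx : x = (Abelian.Ext.mk₀ e.inv).comp
      ((Abelian.Ext.mk₀ e.hom).comp x (zero_add 1)) (zero_add 1) := by simp
  rw [hx, h ((Abelian.Ext.mk₀ e.hom).comp x (zero_add 1)), Abelian.Ext.comp_zero]

/-- The morphism `v : X₃ ⟶ Z⁰(T⟦1⟧)` is obtained from `u : X₁ ⟶ Z⁰(T)` by a morphism from
the short complex `S` to `0 ⟶ Z⁰(T) ⟶ T⁰ ⟶ Z⁰(T⟦1⟧) ⟶ 0`. The sign is that of the connecting
morphism of the triangle of a degreewise split exact sequence of complexes. -/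
def IsConnecting (S : ShortComplex A) (T : CochainComplex A ℤ) (u : S.X₁ ⟶ T.cycles 0)
    (v : S.X₃ ⟶ (T⟦(1 : ℤ)⟧).cycles 0) : Prop :=
  ∃ w : S.X₂ ⟶ T.X 0, S.f ≫ w = u ≫ T.iCycles 0 ∧ w ≫ T.d 0 1 = -(S.g ≫ v ≫ iCyclesShift T)

lemma exists_isConnecting {S : ShortComplex A} (hS : S.ShortExact) (h₃ : gorenstein U S.X₃)
    {T : CochainComplex A ℤ} (hT : IsTotallyAcyclic U T) (u : S.X₁ ⟶ T.cycles 0) :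
    ∃ v, IsConnecting S T u v := by
  obtain ⟨w, hw⟩ := exists_desc_of_gorenstein hS h₃ (hT.mem 0) (hT.rightOrthogonal_X 0)
    (u ≫ T.iCycles 0)
  have hw' : S.f ≫ w ≫ T.d 0 1 = 0 := by rw [reassoc_of% hw, iCycles_d, comp_zero]
  obtain ⟨c, hc⟩ : ∃ c : S.X₃ ⟶ T.X 1, S.g ≫ c = w ≫ T.d 0 1 :=
    ⟨hS.gIsCokernel.desc (CokernelCofork.ofπ _ hw'),
      hS.gIsCokernel.fac (CokernelCofork.ofπ _ hw') WalkingParallelPair.one⟩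
  have := hS.epi_g
  obtain ⟨v, hv⟩ := exists_lift_iCyclesShift T (-c) (by
    rw [← cancel_epi S.g, Preadditive.neg_comp, Preadditive.comp_neg, reassoc_of% hc]
    simp)
  exact ⟨v, w, hw, by rw [hv, Preadditive.comp_neg, hc, neg_neg]⟩

namespace IsConnecting

variable {S : ShortComplex A} {T : CochainComplex A ℤ} {u : S.X₁ ⟶ T.cycles 0}
  {v : S.X₃ ⟶ (T⟦(1 : ℤ)⟧).cycles 0}

lemma comp_cyclesMap (h : IsConnecting S T u v) {T' : CochainComplex A ℤ} (φ : T ⟶ T') :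
    IsConnecting S T' (u ≫ cyclesMap φ 0) (v ≫ cyclesMap (φ⟦(1 : ℤ)⟧') 0) := by
  obtain ⟨w, hw, hw'⟩ := h
  refine ⟨w ≫ φ.f 0, ?_, ?_⟩
  · rw [reassoc_of% hw, Category.assoc, cyclesMap_i]
  · rw [Category.assoc, φ.comm, reassoc_of% hw', Preadditive.neg_comp, Category.assoc,
      Category.assoc, Category.assoc, cyclesMap_shift_iCyclesShift]

lemma map_comp (h : IsConnecting S T u v) {S' : ShortComplex A} (ψ : S' ⟶ S) :
    IsConnecting S' T (ψ.τ₁ ≫ u) (ψ.τ₃ ≫ v) := by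
  obtain ⟨w, hw, hw'⟩ := h
  refine ⟨ψ.τ₂ ≫ w, ?_, ?_⟩
  · rw [← ψ.comm₁₂_assoc, hw, Category.assoc]
  · rw [Category.assoc, hw', Preadditive.comp_neg, ψ.comm₂₃_assoc, Category.assoc]

/-- The connecting morphisms attached to a given `u` differ by a morphism which factors
through `T⁰`. -/
lemma exists_sub_eq (hS : S.ShortExact) (h : IsConnecting S T u v)
    {v' : S.X₃ ⟶ (T⟦(1 : ℤ)⟧).cycles 0} (h' : IsConnecting S T u v') :
    ∃ (a : S.X₃ ⟶ T.X 0) (b : T.X 0 ⟶ (T⟦(1 : ℤ)⟧).cycles 0), a ≫ b = v - v' := by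
  obtain ⟨w, hw, hw'⟩ := h
  obtain ⟨x, hx, hx'⟩ := h'
  obtain ⟨b, hb⟩ := exists_lift_iCyclesShift T (T.d 0 1) (by simp)
  have h₀ : S.f ≫ (x - w) = 0 := by rw [Preadditive.comp_sub, hw, hx, sub_self]
  obtain ⟨a, ha⟩ : ∃ a : S.X₃ ⟶ T.X 0, S.g ≫ a = x - w :=
    ⟨hS.gIsCokernel.desc (CokernelCofork.ofπ _ h₀),
      hS.gIsCokernel.fac (CokernelCofork.ofπ _ h₀) WalkingParallelPair.one⟩
  have := hS.epi_g
  refine ⟨a, b, ?_⟩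
  rw [← cancel_mono (iCyclesShift T), ← cancel_epi S.g, Category.assoc, hb, reassoc_of% ha,
    Preadditive.sub_comp, hw', hx', Preadditive.sub_comp, Preadditive.comp_sub]
  abel

end IsConnecting

variable {T₁ T₃ : CochainComplex A ℤ} (γ : T₃ ⟶ T₁⟦(1 : ℤ)⟧)

lemma isConnecting_extensionSequence :
    IsConnecting (cyclesShortComplex (extensionSequence γ)) T₁ (𝟙 _) (cyclesMap γ 0) := by
  refine ⟨iCyclesExtension γ ≫ biprod.fst, ?_, iCyclesExtension_fst_d γ⟩
  rw [reassoc_of% cyclesMap_iCyclesExtension γ, biprod.inl_fst, Category.comp_id]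
  exact (Category.id_comp _).symm

lemma lift_extensionD {X : A} (a : X ⟶ T₁.X 0) (b : X ⟶ T₃.cycles 0)
    (h : a ≫ T₁.d 0 1 = -(b ≫ cyclesMap γ 0 ≫ iCyclesShift T₁)) :
    biprod.lift a (b ≫ T₃.iCycles 0) ≫ extensionD γ 0 = 0 := by
  have h' : cyclesMap γ 0 ≫ iCyclesShift T₁ = T₃.iCycles 0 ≫ shiftHomApp γ 0 :=
    cyclesMap_iCyclesShift γ _ rfl
  rw [h', ← neg_eq_iff_eq_neg, neg_eq_iff_add_eq_zero] at h
  apply biprod.hom_ext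
  · simpa [extensionD] using h
  · simp [extensionD]

/-- A short exact sequence is determined by its connecting morphism. -/
lemma exists_hom_cyclesShortComplex_extensionSequence {S : ShortComplex A}
    {u : S.X₁ ⟶ T₁.cycles 0} {v : S.X₃ ⟶ (T₁⟦(1 : ℤ)⟧).cycles 0} (h : IsConnecting S T₁ u v)
    (q : S.X₃ ⟶ T₃.cycles 0) (hγ : q ≫ cyclesMap γ 0 = v) :
    ∃ ψ : S ⟶ cyclesShortComplex (extensionSequence γ), ψ.τ₁ = u ∧ ψ.τ₃ = q := by
  obtain ⟨w, hw, hw'⟩ := h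
  subst hγ
  obtain ⟨m, hm⟩ : ∃ m, m ≫ iCyclesExtension γ = biprod.lift w ((S.g ≫ q) ≫ T₃.iCycles 0) :=
    ⟨(extension γ).liftCycles
      (biprod.lift w ((S.g ≫ q) ≫ T₃.iCycles 0) : S.X₂ ⟶ T₁.X 0 ⊞ T₃.X 0) 1 (by simp) (by
        refine Eq.trans (congrArg _ (extension_d γ 0)) (lift_extensionD γ w (S.g ≫ q) ?_)
        simpa using hw'), liftCycles_i _ _ _ _ _⟩
  refine ⟨{ τ₁ := u, τ₂ := m, τ₃ := q, comm₁₂ := ?_, comm₂₃ := ?_ }, rfl, rfl⟩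
  · rw [← cancel_mono (iCyclesExtension γ), Category.assoc, cyclesMap_iCyclesExtension,
      Category.assoc, hm]
    apply biprod.hom_ext
    · simp [hw]
    · simp
  · rw [← cancel_mono (T₃.iCycles 0), Category.assoc, ← iCyclesExtension_snd, reassoc_of% hm,
      biprod.lift_snd, Category.assoc]

variable (U) [U.IsClosedUnderFiniteProducts] [U.IsClosedUnderIsomorphisms]

instance : (gorenstein U).IsClosedUnderExtensions where
  prop_X₂_of_shortExact {S} hS h₁ h₃ := by
    have h₃' := h₃
    obtain ⟨T₁, hT₁, ⟨e₁⟩⟩ := h₁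
    obtain ⟨T₃, hT₃, ⟨e₃⟩⟩ := h₃'
    obtain ⟨v, hv⟩ := exists_isConnecting hS h₃ hT₁ e₁.inv
    obtain ⟨γ, hγ⟩ := hT₃.exists_cyclesMap_eq (hT₁.shift 1) (e₃.hom ≫ v)
    obtain ⟨ψ, hψ₁, hψ₃⟩ := exists_hom_cyclesShortComplex_extensionSequence γ hv e₃.inv
      (by simp [hγ])
    have : IsIso ψ.τ₁ := by rw [hψ₁]; exact e₁.isIso_inv
    have : IsIso ψ.τ₃ := by rw [hψ₃]; exact e₃.isIso_inv
    have := ShortComplex.isIso₂_of_shortExact_of_isIso₁₃ ψ hS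
      (cyclesShortComplex_extensionSequence_shortExact γ hT₁.acyclic)
    exact ⟨extension γ, hT₁.extension γ hT₃, ⟨(asIso ψ.τ₂).symm⟩⟩

variable {U}

lemma IsRelProjective.of_retract {P : ObjectProperty A} {I J : P.FullSubcategory}
    (hJ : IsRelProjective P J) (r : Retract I J) : IsRelProjective P I := by
  intro S hS f
  obtain ⟨g, hg⟩ := hJ S hS (r.r ≫ f)
  exact ⟨r.i ≫ g, by rw [Category.assoc, hg, r.retract_assoc]⟩

lemma IsRelInjective.of_retract {P : ObjectProperty A} {I J : P.FullSubcategory}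
    (hJ : IsRelInjective P J) (r : Retract I J) : IsRelInjective P I := by
  intro S hS f
  obtain ⟨g, hg⟩ := hJ S hS (f ≫ r.i)
  exact ⟨g ≫ r.r, by rw [reassoc_of% hg, r.retract, Category.comp_id]⟩

variable (U)

lemma exists_conflation_X₃ (X : (gorenstein U).FullSubcategory) :
    ∃ S : ShortComplex (gorenstein U).FullSubcategory, IsConflation (gorenstein U) S ∧
      IsRelProjective (gorenstein U) S.X₂ ∧ IsRelInjective (gorenstein U) S.X₂ ∧
      Nonempty (S.X₃ ≅ X) := by
  obtain ⟨T, hT, ⟨e⟩⟩ := X.property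
  exact ⟨_, hT.isConflation (-1) 0 (by simp), isRelProjective_X hT _, isRelInjective_X hT _,
    ⟨(gorenstein U).isoMk e⟩⟩

lemma exists_conflation_X₁ (X : (gorenstein U).FullSubcategory) :
    ∃ S : ShortComplex (gorenstein U).FullSubcategory, IsConflation (gorenstein U) S ∧
      IsRelProjective (gorenstein U) S.X₂ ∧ IsRelInjective (gorenstein U) S.X₂ ∧
      Nonempty (S.X₁ ≅ X) := by
  obtain ⟨T, hT, ⟨e⟩⟩ := X.property
  exact ⟨_, hT.isConflation 0 1 (by simp), isRelProjective_X hT _, isRelInjective_X hT _,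
    ⟨(gorenstein U).isoMk e⟩⟩

lemma isRelProjective_iff_isRelInjective (I : (gorenstein U).FullSubcategory) :
    IsRelProjective (gorenstein U) I ↔ IsRelInjective (gorenstein U) I := by
  constructor
  · intro hI
    obtain ⟨S, hS, -, hS₂, ⟨e⟩⟩ := exists_conflation_X₃ U I
    obtain ⟨s, hs⟩ := hI S hS e.inv
    exact hS₂.of_retract ⟨s, S.g ≫ e.hom, by rw [reassoc_of% hs, e.inv_hom_id]⟩
  · intro hI
    obtain ⟨S, hS, hS₂, -, ⟨e⟩⟩ := exists_conflation_X₁ U I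
    obtain ⟨r, hr⟩ := hI S hS e.hom
    exact hS₂.of_retract ⟨e.inv ≫ S.f, r, by rw [Category.assoc, hr, e.inv_hom_id]⟩

lemma isFrobenius_gorenstein : IsFrobenius (gorenstein U) where
  additive := inferInstance
  closedUnderExtensions := inferInstance
  enough_projectives X := by
    obtain ⟨S, hS, h, -, e⟩ := exists_conflation_X₃ U X
    exact ⟨S, hS, h, e⟩
  enough_injectives X := by
    obtain ⟨S, hS, -, h, e⟩ := exists_conflation_X₁ U X
    exact ⟨S, hS, h, e⟩
  projective_iff_injective := isRelProjective_iff_isRelInjective U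

end Connecting

section Standard

open HomologicalComplex CochainComplex Pretriangulated

variable {U : ObjectProperty A}

/-- The object of degree-`0` cycles of a totally acyclic complex, as a right Gorenstein object. -/
noncomputable abbrev IsTotallyAcyclic.cyclesObj {T : CochainComplex A ℤ}
    (hT : IsTotallyAcyclic U T) : (gorenstein U).FullSubcategory :=
  ⟨T.cycles 0, hT.gorenstein_cycles 0⟩

/-- A totally acyclic complex as an object of the homotopy category. -/
abbrev IsTotallyAcyclic.homotopyObj {T : CochainComplex A ℤ} (hT : IsTotallyAcyclic U T) :
    (totallyAcyclic U).FullSubcategory :=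
  ⟨(HomotopyCategory.quotient A (ComplexShape.up ℤ)).obj T, hT⟩

/-- The morphism in the homotopy category of totally acyclic complexes given by a chain map. -/
def homotopyMap {T T' : CochainComplex A ℤ} (hT : IsTotallyAcyclic U T)
    (hT' : IsTotallyAcyclic U T') (φ : T ⟶ T') : hT.homotopyObj ⟶ hT'.homotopyObj :=
  ObjectProperty.homMk ((HomotopyCategory.quotient A (ComplexShape.up ℤ)).map φ)

/-- The morphism induced on degree-`0` cycles by a chain map. -/
noncomputable abbrev cyclesHom {T T' : CochainComplex A ℤ} (hT : IsTotallyAcyclic U T)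
    (hT' : IsTotallyAcyclic U T') (φ : T ⟶ T') : hT.cyclesObj ⟶ hT'.cyclesObj :=
  ObjectProperty.homMk (cyclesMap φ 0)

/-- The relation `IsConnecting` for conflations of right Gorenstein objects. -/
def IsConflationConnecting (S : ShortComplex (gorenstein U).FullSubcategory)
    {T : CochainComplex A ℤ} (hT : IsTotallyAcyclic U T) (u : S.X₁ ⟶ hT.cyclesObj)
    (v : S.X₃ ⟶ (hT.shift 1).cyclesObj) : Prop :=
  IsConnecting (S.map (gorenstein U).ι) T u.hom v.hom

lemma exists_isConflationConnecting {S : ShortComplex (gorenstein U).FullSubcategory}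
    (hS : IsConflation (gorenstein U) S) {T : CochainComplex A ℤ} (hT : IsTotallyAcyclic U T)
    (u : S.X₁ ⟶ hT.cyclesObj) : ∃ v, IsConflationConnecting S hT u v := by
  obtain ⟨v, hv⟩ := exists_isConnecting (S := S.map (gorenstein U).ι) hS S.X₃.property hT u.hom
  exact ⟨ObjectProperty.homMk v, hv⟩

namespace IsConflationConnecting

variable {S : ShortComplex (gorenstein U).FullSubcategory} {T : CochainComplex A ℤ}
  {hT : IsTotallyAcyclic U T} {u : S.X₁ ⟶ hT.cyclesObj} {v : S.X₃ ⟶ (hT.shift 1).cyclesObj}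

lemma comp_cyclesHom (h : IsConflationConnecting S hT u v) {T' : CochainComplex A ℤ}
    (hT' : IsTotallyAcyclic U T') (φ : T ⟶ T') :
    IsConflationConnecting S hT' (u ≫ cyclesHom hT hT' φ)
      (v ≫ cyclesHom (hT.shift 1) (hT'.shift 1) (φ⟦(1 : ℤ)⟧')) :=
  h.comp_cyclesMap φ

lemma map_comp (h : IsConflationConnecting S hT u v)
    {S' : ShortComplex (gorenstein U).FullSubcategory} (ψ : S' ⟶ S) :
    IsConflationConnecting S' hT (ψ.τ₁ ≫ u) (ψ.τ₃ ≫ v) :=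
  IsConnecting.map_comp h ((gorenstein U).ι.mapShortComplex.map ψ)

end IsConflationConnecting

variable (U) in
/-- A choice of totally acyclic complexes for all right Gorenstein objects. -/
noncomputable def arbitraryResolutionChoice : ResolutionChoice U where
  complex M := M.property.choose
  isTotallyAcyclic M := M.property.choose_spec.1
  iso M := M.property.choose_spec.2.some

/-- The isomorphism in `gorenstein U` between the cycles of the chosen complex of an object and
this object. -/
noncomputable def ResolutionChoice.cyclesObjIso (R : ResolutionChoice U)
    (M : (gorenstein U).FullSubcategory) : (R.isTotallyAcyclic M).cyclesObj ≅ M :=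
  (gorenstein U).isoMk (R.iso M)

/-- The morphism from `X₃` to the cycles of the shift of the chosen complex of `X₁`
attached to a conflation. -/
noncomputable def connectingHom {S : ShortComplex (gorenstein U).FullSubcategory}
    (hS : IsConflation (gorenstein U) S) :
    S.X₃ ⟶ (((arbitraryResolutionChoice U).isTotallyAcyclic S.X₁).shift 1).cyclesObj :=
  (exists_isConflationConnecting hS ((arbitraryResolutionChoice U).isTotallyAcyclic S.X₁)
    ((arbitraryResolutionChoice U).cyclesObjIso S.X₁).inv).choose

lemma isConflationConnecting_connectingHom {S : ShortComplex (gorenstein U).FullSubcategory}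
    (hS : IsConflation (gorenstein U) S) :
    IsConflationConnecting S ((arbitraryResolutionChoice U).isTotallyAcyclic S.X₁)
      ((arbitraryResolutionChoice U).cyclesObjIso S.X₁).inv (connectingHom hS) :=
  (exists_isConflationConnecting hS ((arbitraryResolutionChoice U).isTotallyAcyclic S.X₁)
    ((arbitraryResolutionChoice U).cyclesObjIso S.X₁).inv).choose_spec

variable [U.IsClosedUnderFiniteProducts] [U.IsClosedUnderIsomorphisms]

/-- The stable class of the morphism induced on degree-`0` cycles by a chain map. -/
noncomputable def stableCyclesMap {T T' : CochainComplex A ℤ} (hT : IsTotallyAcyclic U T)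
    (hT' : IsTotallyAcyclic U T') (φ : T ⟶ T') :
    (stableQuotient (gorenstein U)).obj hT.cyclesObj ⟶
      (stableQuotient (gorenstein U)).obj hT'.cyclesObj :=
  (stableQuotient (gorenstein U)).map (cyclesHom hT hT' φ)

lemma cyclesZero_map_homotopyMap {T T' : CochainComplex A ℤ} (hT : IsTotallyAcyclic U T)
    (hT' : IsTotallyAcyclic U T') (φ : T ⟶ T') :
    (cyclesZero U).map (homotopyMap hT hT' φ) = stableCyclesMap hT hT' φ :=
  cyclesZero_map U (T := hT.homotopyObj) (T' := hT'.homotopyObj) φ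

/-- The shift of totally acyclic complexes is compatible with the shift in the homotopy
category. -/
noncomputable def homotopyObjShiftIso {T : CochainComplex A ℤ} (hT : IsTotallyAcyclic U T) :
    (hT.shift 1).homotopyObj ≅ hT.homotopyObj⟦(1 : ℤ)⟧ :=
  (totallyAcyclic U).ι.preimageIso
    (((HomotopyCategory.quotient A (ComplexShape.up ℤ)).commShiftIso (1 : ℤ)).app T ≪≫
      ((totallyAcyclic U).ι.commShiftIso (1 : ℤ)).symm.app hT.homotopyObj)

lemma ι_map_homotopyObjShiftIso_hom {T : CochainComplex A ℤ} (hT : IsTotallyAcyclic U T) :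
    (totallyAcyclic U).ι.map (homotopyObjShiftIso hT).hom ≫
      ((totallyAcyclic U).ι.commShiftIso (1 : ℤ)).hom.app hT.homotopyObj =
    ((HomotopyCategory.quotient A (ComplexShape.up ℤ)).commShiftIso (1 : ℤ)).hom.app T := by
  rw [homotopyObjShiftIso, Functor.preimageIso_hom, Functor.map_preimage, Iso.trans_hom]
  refine (Category.assoc _ _ _).trans ((congrArg (_ ≫ ·) ?_).trans (Category.comp_id _))
  exact ((totallyAcyclic U).ι.commShiftIso (1 : ℤ)).inv_hom_id_app hT.homotopyObj

lemma homotopyMap_shift {T T' : CochainComplex A ℤ} (hT : IsTotallyAcyclic U T)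
    (hT' : IsTotallyAcyclic U T') (φ : T ⟶ T') :
    homotopyMap (hT.shift 1) (hT'.shift 1) (φ⟦(1 : ℤ)⟧') ≫ (homotopyObjShiftIso hT').hom =
      (homotopyObjShiftIso hT).hom ≫ (homotopyMap hT hT' φ)⟦(1 : ℤ)⟧' := by
  apply (totallyAcyclic U).ι.map_injective
  have h₁ := (HomotopyCategory.quotient A (ComplexShape.up ℤ)).commShiftIso_hom_naturality φ
    (1 : ℤ)
  have h₂ := (totallyAcyclic U).ι.commShiftIso_inv_naturality (homotopyMap hT hT' φ) (1 : ℤ)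
  simp only [homotopyObjShiftIso, Functor.map_comp, Functor.preimageIso_hom, Functor.map_preimage,
    Iso.trans_hom, Iso.app_hom, Iso.symm_hom, Category.assoc]
  refine (Category.assoc _ _ _).symm.trans ((congrArg (· ≫ _) h₁).trans ?_)
  exact (Category.assoc _ _ _).trans (congrArg _ h₂)

/-- The isomorphism between the cycles of `T⟦1⟧` and the shift of the cycles of `T` in the stable
category. -/
noncomputable def cyclesShiftStableIso {T : CochainComplex A ℤ} (hT : IsTotallyAcyclic U T) :
    (stableQuotient (gorenstein U)).obj (hT.shift 1).cyclesObj ≅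
      ((stableQuotient (gorenstein U)).obj hT.cyclesObj)⟦(1 : ℤ)⟧ :=
  (cyclesZero U).mapIso (homotopyObjShiftIso hT) ≪≫
    ((cyclesZero U).commShiftIso (1 : ℤ)).app hT.homotopyObj

lemma stableCyclesMap_shift {T T' : CochainComplex A ℤ} (hT : IsTotallyAcyclic U T)
    (hT' : IsTotallyAcyclic U T') (φ : T ⟶ T') :
    stableCyclesMap (hT.shift 1) (hT'.shift 1) (φ⟦(1 : ℤ)⟧') ≫ (cyclesShiftStableIso hT').hom =
      (cyclesShiftStableIso hT).hom ≫ (stableCyclesMap hT hT' φ)⟦(1 : ℤ)⟧' := by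
  have h₁ := congrArg (cyclesZero U).map (homotopyMap_shift hT hT' φ)
  have h₂ := (cyclesZero U).commShiftIso_hom_naturality (homotopyMap hT hT' φ) (1 : ℤ)
  rw [Functor.map_comp, Functor.map_comp, cyclesZero_map_homotopyMap] at h₁
  rw [cyclesZero_map_homotopyMap] at h₂
  refine (Category.assoc _ _ _).symm.trans ((congrArg (· ≫ _) h₁).trans ?_)
  refine (Category.assoc _ _ _).trans ((congrArg (_ ≫ ·) h₂).trans (Category.assoc _ _ _).symm)

namespace IsConflationConnecting

variable {S : ShortComplex (gorenstein U).FullSubcategory} {T : CochainComplex A ℤ}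
  {hT : IsTotallyAcyclic U T} {u : S.X₁ ⟶ hT.cyclesObj} {v : S.X₃ ⟶ (hT.shift 1).cyclesObj}

/-- The connecting morphisms attached to a given morphism `u` coincide in the stable category. -/
lemma stableQuotient_map_eq (hS : IsConflation (gorenstein U) S)
    (h : IsConflationConnecting S hT u v) {v' : S.X₃ ⟶ (hT.shift 1).cyclesObj}
    (h' : IsConflationConnecting S hT u v') :
    (stableQuotient (gorenstein U)).map v = (stableQuotient (gorenstein U)).map v' := by
  obtain ⟨a, b, hab⟩ := IsConnecting.exists_sub_eq (S := S.map (gorenstein U).ι) hS h h'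
  refine RightGorenstein.stableQuotient_map_eq ⟨⟨T.X 0, gorenstein_X hT 0⟩, ObjectProperty.homMk a,
    ObjectProperty.homMk b, isRelProjective_X hT 0, isRelInjective_X hT 0, ?_⟩
  ext
  exact hab

end IsConflationConnecting

/-- The connecting morphism of a conflation, in the stable category. -/
noncomputable def stableδ (S : ShortComplex (gorenstein U).FullSubcategory)
    (hS : IsConflation (gorenstein U) S) : (stableQuotient (gorenstein U)).obj S.X₃ ⟶
      ((stableQuotient (gorenstein U)).obj S.X₁)⟦(1 : ℤ)⟧ :=
  (stableQuotient (gorenstein U)).map (connectingHom hS) ≫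
    (cyclesShiftStableIso ((arbitraryResolutionChoice U).isTotallyAcyclic S.X₁)).hom ≫
    ((stableQuotient (gorenstein U)).map
      ((arbitraryResolutionChoice U).cyclesObjIso S.X₁).hom)⟦(1 : ℤ)⟧'

/-- The connecting morphism can be computed using any totally acyclic complex. -/
lemma IsConflationConnecting.map_comp_cyclesShiftStableIso_hom
    {S : ShortComplex (gorenstein U).FullSubcategory} (hS : IsConflation (gorenstein U) S)
    {T : CochainComplex A ℤ} {hT : IsTotallyAcyclic U T} {u : S.X₁ ⟶ hT.cyclesObj}
    {v : S.X₃ ⟶ (hT.shift 1).cyclesObj} (h : IsConflationConnecting S hT u v) :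
    (stableQuotient (gorenstein U)).map v ≫ (cyclesShiftStableIso hT).hom =
      stableδ S hS ≫ ((stableQuotient (gorenstein U)).map u)⟦(1 : ℤ)⟧' := by
  let R := arbitraryResolutionChoice U
  obtain ⟨φ, hφ⟩ := (R.isTotallyAcyclic S.X₁).exists_cyclesMap_eq hT
    ((R.cyclesObjIso S.X₁).hom ≫ u).hom
  have hφ' : cyclesHom (R.isTotallyAcyclic S.X₁) hT φ = (R.cyclesObjIso S.X₁).hom ≫ u := by
    ext; exact hφ
  have h₁ := (isConflationConnecting_connectingHom hS).comp_cyclesHom hT φ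
  rw [hφ', Iso.inv_hom_id_assoc] at h₁
  rw [h.stableQuotient_map_eq hS h₁, Functor.map_comp, Category.assoc]
  refine (congrArg (_ ≫ ·) (stableCyclesMap_shift (R.isTotallyAcyclic S.X₁) hT φ)).trans ?_
  rw [stableCyclesMap, hφ', Functor.map_comp, Functor.map_comp, stableδ]
  simp only [Category.assoc]
  rfl

lemma stableδ_naturality (S S' : ShortComplex (gorenstein U).FullSubcategory)
    (hS : IsConflation (gorenstein U) S) (hS' : IsConflation (gorenstein U) S') (φ : S ⟶ S') :
    (stableQuotient (gorenstein U)).map φ.τ₃ ≫ stableδ S' hS' =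
      stableδ S hS ≫ ((stableQuotient (gorenstein U)).map φ.τ₁)⟦(1 : ℤ)⟧' := by
  have h := ((isConflationConnecting_connectingHom hS').map_comp
    φ).map_comp_cyclesShiftStableIso_hom hS
  rw [Functor.map_comp, Category.assoc] at h
  rw [stableδ, reassoc_of% h, ← Functor.map_comp, ← Functor.map_comp, Category.assoc,
    Iso.inv_hom_id, Category.comp_id]

section

variable {T₁ T₃ : CochainComplex A ℤ} (hT₁ : IsTotallyAcyclic U T₁) (hT₃ : IsTotallyAcyclic U T₃)
  (γ : T₃ ⟶ T₁⟦(1 : ℤ)⟧)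

/-- The conflation of right Gorenstein objects given by a morphism `T₃ ⟶ T₁⟦1⟧`. -/
noncomputable abbrev extensionConflation : ShortComplex (gorenstein U).FullSubcategory :=
  ShortComplex.mk (X₁ := hT₁.cyclesObj) (X₂ := (hT₁.extension γ hT₃).cyclesObj)
    (X₃ := hT₃.cyclesObj) (ObjectProperty.homMk (cyclesMap (extensionSequence γ).f 0))
    (ObjectProperty.homMk (cyclesMap (extensionSequence γ).g 0))
    (by ext; exact (cyclesShortComplex (extensionSequence γ)).zero)

lemma isConflation_extensionConflation :
    IsConflation (gorenstein U) (extensionConflation hT₁ hT₃ γ) :=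
  cyclesShortComplex_extensionSequence_shortExact γ hT₁.acyclic

lemma stableδ_extensionConflation :
    stableδ (extensionConflation hT₁ hT₃ γ) (isConflation_extensionConflation hT₁ hT₃ γ) =
      stableCyclesMap hT₃ (hT₁.shift 1) γ ≫ (cyclesShiftStableIso hT₁).hom := by
  have h : IsConflationConnecting (extensionConflation hT₁ hT₃ γ) hT₁ (𝟙 _)
    (cyclesHom hT₃ (hT₁.shift 1) γ) := isConnecting_extensionSequence γ
  have h' := h.map_comp_cyclesShiftStableIso_hom (isConflation_extensionConflation hT₁ hT₃ γ)
  rw [CategoryTheory.Functor.map_id, CategoryTheory.Functor.map_id, Category.comp_id] at h'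
  exact h'.symm

lemma homotopy_triangle_distinguished :
    Triangle.mk (homotopyMap hT₁ (hT₁.extension γ hT₃) (extensionSequence γ).f)
      (homotopyMap (hT₁.extension γ hT₃) hT₃ (extensionSequence γ).g)
      (homotopyMap hT₃ (hT₁.shift 1) γ ≫ (homotopyObjShiftIso hT₁).hom) ∈
    distTriang (totallyAcyclic U).FullSubcategory := by
  have h := (HomotopyCategory.distinguished_iff_iso_trianglehOfDegreewiseSplit
    (trianglehOfDegreewiseSplit (extensionSequence γ) (extensionSplitting γ))).2
      ⟨_, _, ⟨Iso.refl _⟩⟩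
  refine isomorphic_distinguished _ h _ (Triangle.isoMk _ _ (Iso.refl _) (Iso.refl _)
    (Iso.refl _) ?_ ?_ ?_)
  · exact (Category.comp_id _).trans (Category.id_comp _).symm
  · exact (Category.comp_id _).trans (Category.id_comp _).symm
  · refine (congrArg (_ ≫ ·) (CategoryTheory.Functor.map_id _ _)).trans
      ((Category.comp_id _).trans (Eq.trans ?_ (Category.id_comp _).symm))
    refine Eq.trans (b := (HomotopyCategory.quotient A (ComplexShape.up ℤ)).map γ ≫
      ((HomotopyCategory.quotient A (ComplexShape.up ℤ)).commShiftIso (1 : ℤ)).hom.app T₁) ?_ ?_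
    · refine (Category.assoc _ _ _).trans ?_
      exact congrArg (_ ≫ ·) (ι_map_homotopyObjShiftIso_hom hT₁)
    · exact congrArg (fun x => (HomotopyCategory.quotient A (ComplexShape.up ℤ)).map x ≫
        ((HomotopyCategory.quotient A (ComplexShape.up ℤ)).commShiftIso (1 : ℤ)).hom.app T₁)
        (homOfDegreewiseSplit_extensionSplitting γ).symm

lemma stable_triangle_distinguished :
    Triangle.mk ((stableQuotient (gorenstein U)).map (extensionConflation hT₁ hT₃ γ).f)
      ((stableQuotient (gorenstein U)).map (extensionConflation hT₁ hT₃ γ).g)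
      (stableδ _ (isConflation_extensionConflation hT₁ hT₃ γ)) ∈
    distTriang (StableCategory (gorenstein U)) := by
  refine isomorphic_distinguished _ ((cyclesZero U).map_distinguished _
    (homotopy_triangle_distinguished hT₁ hT₃ γ)) _ (Triangle.isoMk _ _ (Iso.refl _) (Iso.refl _)
    (Iso.refl _) ?_ ?_ ?_)
  · exact (Category.comp_id _).trans
      ((cyclesZero_map_homotopyMap _ _ _).symm.trans (Category.id_comp _).symm)
  · exact (Category.comp_id _).trans
      ((cyclesZero_map_homotopyMap _ _ _).symm.trans (Category.id_comp _).symm)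
  · refine (congrArg (_ ≫ ·) (CategoryTheory.Functor.map_id _ _)).trans
      ((Category.comp_id _).trans (Eq.trans ?_ (Category.id_comp _).symm))
    refine (stableδ_extensionConflation hT₁ hT₃ γ).trans ?_
    have h := (cyclesZero U).map_comp (homotopyMap hT₃ (hT₁.shift 1) γ)
      (homotopyObjShiftIso hT₁).hom
    rw [cyclesZero_map_homotopyMap] at h
    exact (Category.assoc _ _ _).symm.trans (congrArg (· ≫ _) h.symm)

end

end Standard

section Triangles

open HomologicalComplex CochainComplex Pretriangulated

variable {U : ObjectProperty A} [U.IsClosedUnderFiniteProducts] [U.IsClosedUnderIsomorphisms]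

/-- Every conflation of right Gorenstein objects is isomorphic to the sequence of cycles of
a degreewise split extension of totally acyclic complexes. -/
lemma exists_iso_extensionConflation (S : ShortComplex (gorenstein U).FullSubcategory)
    (hS : IsConflation (gorenstein U) S) :
    ∃ (T₁ T₃ : CochainComplex A ℤ) (hT₁ : IsTotallyAcyclic U T₁) (hT₃ : IsTotallyAcyclic U T₃)
      (γ : T₃ ⟶ T₁⟦(1 : ℤ)⟧), Nonempty (S ≅ extensionConflation hT₁ hT₃ γ) := by
  let R := arbitraryResolutionChoice U
  have hT₁ := R.isTotallyAcyclic S.X₁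
  have hT₃ := R.isTotallyAcyclic S.X₃
  obtain ⟨γ, hγ⟩ := hT₃.exists_cyclesMap_eq (hT₁.shift 1)
    ((R.iso S.X₃).hom ≫ (connectingHom hS).hom)
  obtain ⟨ψ, h₁, h₃⟩ := exists_hom_cyclesShortComplex_extensionSequence γ
    (isConflationConnecting_connectingHom hS) (R.iso S.X₃).inv
    (by rw [hγ]; exact Iso.inv_hom_id_assoc _ _)
  have this₁ : IsIso ψ.τ₁ := by
    rw [h₁]
    exact (R.iso S.X₁).symm.isIso_hom
  have this₃ : IsIso ψ.τ₃ := by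
    rw [h₃]
    exact (R.iso S.X₃).symm.isIso_hom
  have this₂ := ShortComplex.isIso₂_of_shortExact_of_isIso₁₃ ψ hS
    (cyclesShortComplex_extensionSequence_shortExact γ hT₁.acyclic)
  refine ⟨_, _, hT₁, hT₃, γ, ⟨ShortComplex.isoMk
    ((gorenstein U).isoMk (@asIso A _ _ _ ψ.τ₁ this₁))
    ((gorenstein U).isoMk (@asIso A _ _ _ ψ.τ₂ this₂))
    ((gorenstein U).isoMk (@asIso A _ _ _ ψ.τ₃ this₃)) ?_ ?_⟩⟩
  · ext
    exact ψ.comm₁₂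
  · ext
    exact ψ.comm₂₃

/-- The triangle in the stable category attached to a conflation. -/
noncomputable abbrev stableTriangle (S : ShortComplex (gorenstein U).FullSubcategory)
    (hS : IsConflation (gorenstein U) S) : Triangle (StableCategory (gorenstein U)) :=
  Triangle.mk ((stableQuotient (gorenstein U)).map S.f) ((stableQuotient (gorenstein U)).map S.g)
    (stableδ S hS)

/-- Isomorphic conflations have isomorphic triangles. -/
noncomputable def stableTriangleIso {S S' : ShortComplex (gorenstein U).FullSubcategory}
    (hS : IsConflation (gorenstein U) S) (hS' : IsConflation (gorenstein U) S') (e : S ≅ S') :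
    stableTriangle S hS ≅ stableTriangle S' hS' :=
  let F := stableQuotient (gorenstein U)
  Triangle.isoMk _ _ (F.mapIso (ShortComplex.π₁.mapIso e)) (F.mapIso (ShortComplex.π₂.mapIso e))
    (F.mapIso (ShortComplex.π₃.mapIso e))
    ((F.map_comp S.f e.hom.τ₂).symm.trans
      ((congrArg F.map e.hom.comm₁₂.symm).trans (F.map_comp e.hom.τ₁ S'.f)))
    ((F.map_comp S.g e.hom.τ₃).symm.trans
      ((congrArg F.map e.hom.comm₂₃.symm).trans (F.map_comp e.hom.τ₂ S'.g)))
    (stableδ_naturality S S' hS hS' e.hom).symm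

lemma stableTriangle_distinguished (S : ShortComplex (gorenstein U).FullSubcategory)
    (hS : IsConflation (gorenstein U) S) :
    stableTriangle S hS ∈ distTriang (StableCategory (gorenstein U)) := by
  obtain ⟨T₁, T₃, hT₁, hT₃, γ, ⟨e⟩⟩ := exists_iso_extensionConflation S hS
  exact isomorphic_distinguished _ (stable_triangle_distinguished hT₁ hT₃ γ) _
    (stableTriangleIso _ _ e)

lemma exists_iso_stableTriangle (t : Triangle (StableCategory (gorenstein U)))
    (ht : t ∈ distTriang (StableCategory (gorenstein U))) :
    ∃ (S : ShortComplex (gorenstein U).FullSubcategory) (hS : IsConflation (gorenstein U) S),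
      Nonempty (t ≅ stableTriangle S hS) := by
  obtain ⟨X₁, ⟨e₁⟩⟩ : ∃ X, Nonempty ((stableQuotient (gorenstein U)).obj X ≅ t.obj₁) :=
    ⟨_, ⟨(stableQuotient (gorenstein U)).objObjPreimageIso t.obj₁⟩⟩
  obtain ⟨X₃, ⟨e₃⟩⟩ : ∃ X, Nonempty ((stableQuotient (gorenstein U)).obj X ≅ t.obj₃) :=
    ⟨_, ⟨(stableQuotient (gorenstein U)).objObjPreimageIso t.obj₃⟩⟩
  obtain ⟨T₁, hT₁, ⟨i₁⟩⟩ := X₁.property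
  obtain ⟨T₃, hT₃, ⟨i₃⟩⟩ := X₃.property
  let j₁ : (stableQuotient (gorenstein U)).obj hT₁.cyclesObj ≅ t.obj₁ :=
    (stableQuotient (gorenstein U)).mapIso ((gorenstein U).isoMk i₁) ≪≫ e₁
  let j₃ : (stableQuotient (gorenstein U)).obj hT₃.cyclesObj ≅ t.obj₃ :=
    (stableQuotient (gorenstein U)).mapIso ((gorenstein U).isoMk i₃) ≪≫ e₃
  obtain ⟨a, ha⟩ := (stableQuotient (gorenstein U)).map_surjective
    (j₃.hom ≫ t.mor₃ ≫ j₁.inv⟦(1 : ℤ)⟧' ≫ (cyclesShiftStableIso hT₁).inv)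
  obtain ⟨γ, hγ⟩ := hT₃.exists_cyclesMap_eq (hT₁.shift 1) a.hom
  have hγ' : cyclesHom hT₃ (hT₁.shift 1) γ = a := by ext; exact hγ
  refine ⟨_, isConflation_extensionConflation hT₁ hT₃ γ, ⟨isoTriangleOfIso₁₃ _ _ ht
    (stable_triangle_distinguished hT₁ hT₃ γ) j₁.symm j₃.symm ?_⟩⟩
  have h := stableδ_extensionConflation hT₁ hT₃ γ
  rw [stableCyclesMap, hγ', ha] at h
  change t.mor₃ ≫ j₁.inv⟦(1 : ℤ)⟧' = j₃.inv ≫ stableδ (extensionConflation hT₁ hT₃ γ) _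
  rw [h]
  simp only [Category.assoc, Iso.inv_hom_id_assoc, Iso.inv_hom_id]
  exact congrArg (_ ≫ ·) (Category.comp_id _).symm

lemma isZero_stableQuotient_obj {I : (gorenstein U).FullSubcategory}
    (hI : IsRelInjective (gorenstein U) I) : IsZero ((stableQuotient (gorenstein U)).obj I) := by
  rw [IsZero.iff_id_eq_zero, ← CategoryTheory.Functor.map_id, ← Functor.map_zero]
  exact stableQuotient_map_eq
    ⟨I, 𝟙 I, 𝟙 I, (isRelProjective_iff_isRelInjective U I).2 hI, hI, by simp⟩

variable (U) in
lemma isStandardTriangulation_gorenstein : IsStandardTriangulation (gorenstein U) := by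
  refine ⟨stableδ, stableδ_naturality, fun S hS h => ?_, fun t => ⟨exists_iso_stableTriangle t, ?_⟩⟩
  · exact (Triangle.isZero₂_iff_isIso₃ _ (stableTriangle_distinguished S hS)).1
      (isZero_stableQuotient_obj h)
  · rintro ⟨S, hS, ⟨e⟩⟩
    exact isomorphic_distinguished _ (stableTriangle_distinguished S hS) _ e

end Triangles

namespace ResolutionChoice

variable {U : ObjectProperty A} (R : ResolutionChoice U)

lemma exists_isLift {M M' : (gorenstein U).FullSubcategory} (f : M ⟶ M') :
    ∃ φ, R.IsLift f φ := by
  obtain ⟨φ, hφ⟩ := (R.isTotallyAcyclic M).exists_cyclesMap_eq (R.isTotallyAcyclic M')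
    ((R.iso M).hom ≫ f.hom ≫ (R.iso M').inv)
  exact ⟨φ, by rw [IsLift, hφ, Category.assoc, Category.assoc, Iso.inv_hom_id, Category.comp_id]⟩

variable [U.IsClosedUnderFiniteProducts] [U.IsClosedUnderIsomorphisms]

/-- The cycles of the chosen complex of `M` are isomorphic to `M` in the stable category. -/
noncomputable def stableIso (M : (gorenstein U).FullSubcategory) :
    (cyclesZero U).obj (R.obj M) ≅ (stableQuotient (gorenstein U)).obj M :=
  (stableQuotient (gorenstein U)).mapIso (R.cyclesObjIso M)

lemma cyclesZero_map_homMk {M M' : (gorenstein U).FullSubcategory} {f : M ⟶ M'}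
    {φ : R.complex M ⟶ R.complex M'} (h : R.IsLift f φ) :
    (cyclesZero U).map (R.homMk φ) ≫ (R.stableIso M').hom =
      (R.stableIso M).hom ≫ (stableQuotient (gorenstein U)).map f := by
  refine (congrArg (· ≫ _) (cyclesZero_map U (T := R.obj M) (T' := R.obj M') φ)).trans ?_
  refine ((stableQuotient (gorenstein U)).map_comp _ (R.cyclesObjIso M').hom).symm.trans
    (Eq.trans (congrArg _ ?_) ((stableQuotient (gorenstein U)).map_comp (R.cyclesObjIso M).hom f))
  ext
  exact h

lemma eq_of_cyclesZero_map_comp_stableIso_hom {M M' : (gorenstein U).FullSubcategory}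
    {a b : R.obj M ⟶ R.obj M'} (h : (cyclesZero U).map a ≫ (R.stableIso M').hom =
      (cyclesZero U).map b ≫ (R.stableIso M').hom) : a = b :=
  (cyclesZero U).map_injective ((cancel_mono _).1 h)

/-- The functor which sends `M` to its chosen complex and `f` to the homotopy class of its lifts. -/
noncomputable def preFunctor : (gorenstein U).FullSubcategory ⥤
    (totallyAcyclic U).FullSubcategory where
  obj := R.obj
  map f := R.homMk (R.exists_isLift f).choose
  map_id M := by
    apply R.eq_of_cyclesZero_map_comp_stableIso_hom
    rw [R.cyclesZero_map_homMk (R.exists_isLift (𝟙 M)).choose_spec, CategoryTheory.Functor.map_id,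
      CategoryTheory.Functor.map_id, Category.comp_id, Category.id_comp]
  map_comp {M₁ M₂ M₃} f g := by
    apply R.eq_of_cyclesZero_map_comp_stableIso_hom
    rw [R.cyclesZero_map_homMk (R.exists_isLift (f ≫ g)).choose_spec, Functor.map_comp,
      Functor.map_comp, Category.assoc, R.cyclesZero_map_homMk (R.exists_isLift g).choose_spec,
      reassoc_of% R.cyclesZero_map_homMk (R.exists_isLift f).choose_spec]

/-- The functor on the stable category given by chosen totally acyclic complexes. -/
noncomputable def functor : StableCategory (gorenstein U) ⥤
    (totallyAcyclic U).FullSubcategory :=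
  CategoryTheory.Quotient.lift (stableRel (gorenstein U)) R.preFunctor (fun M M' f g h => by
    apply R.eq_of_cyclesZero_map_comp_stableIso_hom
    refine (R.cyclesZero_map_homMk (R.exists_isLift f).choose_spec).trans
      (Eq.trans ?_ (R.cyclesZero_map_homMk (R.exists_isLift g).choose_spec).symm)
    rw [stableQuotient_map_eq h])

lemma functor_map {M M' : (gorenstein U).FullSubcategory} {f : M ⟶ M'}
    {φ : R.complex M ⟶ R.complex M'} (h : R.IsLift f φ) :
    R.functor.map ((stableQuotient (gorenstein U)).map f) = R.homMk φ :=
  R.eq_of_cyclesZero_map_comp_stableIso_hom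
    ((R.cyclesZero_map_homMk (R.exists_isLift f).choose_spec).trans
      (R.cyclesZero_map_homMk h).symm)

lemma isResolutionFunctor_functor : R.IsResolutionFunctor R.functor where
  obj_eq _ := rfl
  exists_lift := R.exists_isLift
  map_eq f φ h := by
    rw [R.functor_map h]
    exact ((Category.id_comp _).trans (Category.comp_id _)).symm

/-- Taking degree-`0` cycles is a left inverse of `R.functor`. -/
noncomputable def functorCompCyclesZeroIso : R.functor ⋙ cyclesZero U ≅ 𝟭 _ :=
  NatIso.ofComponents (fun X => R.stableIso X.as) (by
    rintro ⟨M⟩ ⟨M'⟩ f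
    obtain ⟨f, rfl⟩ := (stableQuotient (gorenstein U)).map_surjective (X := M) (Y := M') f
    exact R.cyclesZero_map_homMk (R.exists_isLift f).choose_spec)

/-- The equivalence between the homotopy category of totally acyclic complexes and the stable
category, with inverse `R.functor`. -/
noncomputable def equivalence :
    (totallyAcyclic U).FullSubcategory ≌ StableCategory (gorenstein U) :=
  (cyclesZeroEquivalence U).changeInverse ((Functor.leftUnitor _).symm ≪≫
    (Iso.isoCompInverse (H := cyclesZeroEquivalence U) R.functorCompCyclesZeroIso).symm)

noncomputable instance : R.equivalence.functor.CommShift ℤ :=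
  inferInstanceAs ((cyclesZero U).CommShift ℤ)

noncomputable instance : R.functor.CommShift ℤ :=
  R.equivalence.commShiftInverse ℤ

noncomputable instance : R.equivalence.inverse.CommShift ℤ :=
  R.equivalence.commShiftInverse ℤ

instance : R.equivalence.CommShift ℤ :=
  R.equivalence.commShift_of_functor ℤ

instance : R.equivalence.IsTriangulated :=
  Equivalence.IsTriangulated.mk' R.equivalence (inferInstanceAs (cyclesZero U).IsTriangulated)

instance : R.functor.IsEquivalence := inferInstanceAs R.equivalence.inverse.IsEquivalence

/-- `R.functor` is left adjoint to the functor of degree-`0` cycles. -/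
noncomputable def functorAdjunction : R.functor ⊣ cyclesZero U := R.equivalence.symm.toAdjunction

/-- `R.functor` is right adjoint to the functor of degree-`0` cycles. -/
noncomputable def adjunctionFunctor : cyclesZero U ⊣ R.functor := R.equivalence.toAdjunction

instance : R.functorAdjunction.IsTriangulated :=
  inferInstanceAs R.equivalence.symm.IsTriangulated

instance : R.adjunctionFunctor.IsTriangulated :=
  inferInstanceAs R.equivalence.IsTriangulated

end ResolutionChoice

end RightGorenstein

theorem theorem3p7 {A : Type u} [Category.{v} A] [Abelian A] (U : ObjectProperty A)
    [U.IsClosedUnderFiniteProducts] [U.IsStableUnderRetracts] :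
    RightGorenstein.IsFrobenius (RightGorenstein.gorenstein U) ∧
    ∃ (_ : HasShift (RightGorenstein.StableCategory (RightGorenstein.gorenstein U)) ℤ)
      (_ : ∀ n : ℤ, (shiftFunctor
        (RightGorenstein.StableCategory (RightGorenstein.gorenstein U)) n).Additive)
      (_ : Pretriangulated (RightGorenstein.StableCategory (RightGorenstein.gorenstein U)))
      (_ : (RightGorenstein.cyclesZero U).CommShift ℤ),
      IsTriangulated (RightGorenstein.StableCategory (RightGorenstein.gorenstein U)) ∧
      RightGorenstein.IsStandardTriangulation (RightGorenstein.gorenstein U) ∧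
      ∀ R : RightGorenstein.ResolutionChoice U,
        ∃ (T : RightGorenstein.StableCategory (RightGorenstein.gorenstein U) ⥤
            (RightGorenstein.totallyAcyclic U).FullSubcategory)
          (_ : T.CommShift ℤ),
          R.IsResolutionFunctor T ∧
          T.IsEquivalence ∧ (RightGorenstein.cyclesZero U).IsEquivalence ∧
          ∃ (adj : T ⊣ RightGorenstein.cyclesZero U) (adj' : RightGorenstein.cyclesZero U ⊣ T),
            adj.IsTriangulated ∧ adj'.IsTriangulated :=
  ⟨RightGorenstein.isFrobenius_gorenstein U, inferInstance, inferInstance, inferInstance,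
    inferInstance, inferInstance, RightGorenstein.isStandardTriangulation_gorenstein U, fun R =>
      ⟨R.functor, inferInstance, R.isResolutionFunctor_functor, inferInstance, inferInstance,
        R.functorAdjunction, R.adjunctionFunctor, inferInstance, inferInstance⟩⟩
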